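/- For a nonzero polynomial $P\in\mathbb{C}[x,y]$ write $$Z(s,P)=\int_0^1\!\!\int_0^1 \left|P(e^{2\pi i\theta_1},e^{2\pi i\theta_2})\right|^s\,d\theta_1\,d\theta_2,\qquad m_k(P)=\int_0^1\!\!\int_0^1 \log^k\left|P(e^{2\pi i\theta_1},e^{2\pi i\theta_2})\right|\,d\theta_1\,d\theta_2$$ for the zeta Mahler measure ($s\in\mathbb{C}$) and the $k$-higher Mahler measure. Let $c\ge 2$ be real. Then the following hold, where all the integrals that occur are absolutely convergent and all the series converge absolutely. (i) For every $s\in\mathbb{C}$ if $c>2$, and for every $s\in\mathbb{C}$ with $\operatorname{Re}(s)>-\tfrac32$ if $c=2$, $$Z(s,x+y+c)=c^s\sum_{j=0}^\infty\binom{s/2}{j}^2\frac{1}{c^{2j}}\binom{2j}{j},$$ where $\binom{z}{j}=z(z-1)\cdots(z-j+1)/j!$. (ii) $$m_2(x+y+c)=\log^2c+\frac12\sum_{k=1}^\infty\binom{2k}{k}\frac{1}{k^2c^{2k}}.$$ (iii) $$m_3(x+y+c)=\log^3c+\frac32\log c\sum_{k=1}^\infty\binom{2k}{k}\frac{1}{k^2c^{2k}}-\frac32\sum_{k=2}^\infty\binom{2k}{k}\frac{1}{k^2c^{2k}}\sum_{j=1}^{k-1}\frac1j.$$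 In particular, (iv) $m_2(x+y+2)=\dfrac{\zeta(2)}{2}$, (v) $m_3(x+y+2)=\dfrac92\,\log 2\;\zeta(2)-\dfrac{15}{4}\,\zeta(3)$. -/

import Mathlib

open MeasureTheory

noncomputable section

/-- The value of `P` at the point `(e^{2πiθ₁}, …, e^{2πiθₙ})` of the unit torus. -/
def torusEval {n : ℕ} (P : MvPolynomial (Fin n) ℂ) (θ : Fin n → ℝ) : ℂ :=
  MvPolynomial.eval (fun i => Complex.exp (2 * Real.pi * Complex.I * (θ i : ℂ))) P

/-- The `k`-higher Mahler measure: the integral of `log^k |P|` over the unit torus. -/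
def higherMahler {n : ℕ} (k : ℕ) (P : MvPolynomial (Fin n) ℂ) : ℝ :=
  ∫ θ in Set.Icc (0 : Fin n → ℝ) 1, Real.log ‖torusEval P θ‖ ^ k

/-- The zeta Mahler measure: the integral of `|P|^s` over the unit torus, for complex `s`. -/
def zetaMahler {n : ℕ} (s : ℂ) (P : MvPolynomial (Fin n) ℂ) : ℂ :=
  ∫ θ in Set.Icc (0 : Fin n → ℝ) 1, (‖torusEval P θ‖ : ℂ) ^ s

/-- The polynomial `x + y + c` in two variables. -/
def polyXYC (c : ℝ) : MvPolynomial (Fin 2) ℂ :=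
  MvPolynomial.X 0 + MvPolynomial.X 1 + MvPolynomial.C (c : ℂ)

end

/-- The standard character `θ ↦ e^{2πiθ}` of the unit additive circle. -/
noncomputable def unitChar (a : UnitAddCircle) : ℂ := (AddCircle.toCircle a : ℂ)

lemma continuous_unitChar : Continuous unitChar :=
  continuous_subtype_val.comp AddCircle.continuous_toCircle

lemma norm_unitChar (a : UnitAddCircle) : ‖unitChar a‖ = 1 := Circle.norm_coe _

lemma unitChar_add (a b : UnitAddCircle) : unitChar (a + b) = unitChar a * unitChar b := by
  simp [unitChar, AddCircle.toCircle_add]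

lemma unitChar_coe (t : ℝ) : unitChar (t : UnitAddCircle) =
    Complex.exp (2 * Real.pi * Complex.I * (t : ℂ)) := by
  simp [unitChar, AddCircle.toCircle_apply_mk, Circle.coe_exp]
  ring_nf

lemma integrable_of_continuous_unitAddCircle {E : Type*} [NormedAddCommGroup E]
    {f : UnitAddCircle → E} (hf : Continuous f) : Integrable f :=
  hf.integrable_of_hasCompactSupport (HasCompactSupport.of_compactSpace f)

instance : IsProbabilityMeasure (volume : Measure UnitAddCircle) := ⟨by simp⟩

lemma integral_unitChar_pow_mul_conj (k j : ℕ) :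
    ∫ a, unitChar a ^ k * (starRingEnd ℂ) (unitChar a ^ j) = if k = j then 1 else 0 := by
  have h1 : ∀ a, unitChar a ^ k * (starRingEnd ℂ) (unitChar a ^ j)
      = fourier (T := 1) ((k : ℤ) - j) a := by
    intro a
    have h2 : ∀ n : ℕ, unitChar a ^ n = fourier (T := 1) (n : ℤ) a := by
      intro n
      simp [fourier_apply, AddCircle.toCircle_nsmul, unitChar]
    rw [h2, h2, ← fourier_neg, ← fourier_add, sub_eq_add_neg]
  simp_rw [h1]
  split_ifs with h
  · subst h; simp
  · have hn : ((k : ℤ) - j) ≠ 0 := by omega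
    have hshift := integral_add_right_eq_self (μ := (volume : Measure UnitAddCircle))
      (fun a => fourier (T := 1) ((k : ℤ) - j) a) ((1 / 2 / ((k : ℤ) - j : ℤ) : ℝ) : UnitAddCircle)
    have h3 := fun a => fourier_add_half_inv_index (T := 1) hn one_pos a
    simp_rw [h3, integral_neg] at hshift
    linear_combination -(1 / 2 : ℂ) * hshift

/-- Parseval's identity for absolutely convergent power series on the unit circle. -/
lemma hasSum_integral_mul_conj {a b : ℕ → ℂ} (ha : Summable fun k => ‖a k‖)
    (hb : Summable fun k => ‖b k‖) :
    HasSum (fun k => a k * (starRingEnd ℂ) (b k))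
      (∫ x, (∑' k, a k * unitChar x ^ k) * (starRingEnd ℂ) (∑' k, b k * unitChar x ^ k)) := by
  have hc := continuous_unitChar
  have bound : ∀ (u : ℕ → ℂ) (k : ℕ) (x : UnitAddCircle), ‖u k * unitChar x ^ k‖ = ‖u k‖ := by
    intro u k x; simp [norm_unitChar]
  have hcb : Continuous fun x => ∑' k, b k * unitChar x ^ k :=
    continuous_tsum (fun k => by fun_prop) hb (fun k x => (bound b k x).le)
  have hle : ∀ x, ‖∑' j, b j * unitChar x ^ j‖ ≤ ∑' j, ‖b j‖ := fun x => by
    simpa only [bound] using norm_tsum_le_tsum_norm (f := fun j => b j * unitChar x ^ j)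
      (by simpa only [bound] using hb)
  have inner : ∀ k : ℕ, ∫ x, unitChar x ^ k * (starRingEnd ℂ) (∑' j, b j * unitChar x ^ j)
      = (starRingEnd ℂ) (b k) := by
    intro k
    have h1 : HasSum (fun j => ∫ x, unitChar x ^ k * (starRingEnd ℂ) (b j * unitChar x ^ j))
        (∫ x, ∑' j, unitChar x ^ k * (starRingEnd ℂ) (b j * unitChar x ^ j)) := by
      refine hasSum_integral_of_summable_integral_norm (fun j =>
        integrable_of_continuous_unitAddCircle (by fun_prop)) ?_
      simpa [norm_unitChar] using hb
    have h2 : ∀ j, ∫ x, unitChar x ^ k * (starRingEnd ℂ) (b j * unitChar x ^ j)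
        = if k = j then (starRingEnd ℂ) (b j) else 0 := by
      intro j
      have : ∀ x, unitChar x ^ k * (starRingEnd ℂ) (b j * unitChar x ^ j)
          = (starRingEnd ℂ) (b j) * (unitChar x ^ k * (starRingEnd ℂ) (unitChar x ^ j)) := by
        intro x; rw [map_mul]; ring
      simp_rw [this, integral_const_mul, integral_unitChar_pow_mul_conj]
      split_ifs <;> simp
    simp_rw [h2] at h1
    have h3 := h1.unique (a₂ := (starRingEnd ℂ) (b k)) (by
      convert hasSum_single k fun j hj => if_neg (Ne.symm hj)
      simp)
    rw [← h3]
    congr 1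
    ext x
    rw [tsum_mul_left, Complex.conj_tsum]
  have hsum := hasSum_integral_of_summable_integral_norm (μ := (volume : Measure UnitAddCircle))
    (F := fun k x => a k * unitChar x ^ k * (starRingEnd ℂ) (∑' j, b j * unitChar x ^ j))
    (fun j => integrable_of_continuous_unitAddCircle (by fun_prop)) (by
      refine Summable.of_nonneg_of_le (fun k => integral_nonneg fun x => norm_nonneg _) (fun k => ?_)
        (ha.mul_right (∑' j, ‖b j‖))
      calc ∫ x, ‖a k * unitChar x ^ k * (starRingEnd ℂ) (∑' j, b j * unitChar x ^ j)‖
          ≤ ∫ _x : UnitAddCircle, ‖a k‖ * ∑' j, ‖b j‖ := by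
            refine integral_mono (integrable_of_continuous_unitAddCircle (by fun_prop))
              (integrable_const _) fun x => ?_
            simp only [norm_mul, RCLike.norm_conj, norm_pow, norm_unitChar, one_pow, mul_one]
            gcongr
            exact hle x
        _ = ‖a k‖ * ∑' j, ‖b j‖ := by simp)
  have term : ∀ k, ∫ x, a k * unitChar x ^ k * (starRingEnd ℂ) (∑' j, b j * unitChar x ^ j)
      = a k * (starRingEnd ℂ) (b k) := fun k => by
    simp_rw [mul_assoc, integral_const_mul, inner]
  simp_rw [term, tsum_mul_right] at hsum
  exact hsum

lemma integral_tsum_unitChar {a : ℕ → ℂ} (ha : Summable fun k => ‖a k‖) :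
    ∫ x, ∑' k, a k * unitChar x ^ k = a 0 := by
  have h := hasSum_integral_mul_conj ha (b := fun k => if k = 0 then 1 else 0)
    (summable_of_ne_finset_zero (s := {0}) (by simp +contextual))
  have h2 : ∀ x, ∑' k : ℕ, (if k = 0 then (1 : ℂ) else 0) * unitChar x ^ k = 1 := by
    intro x
    rw [tsum_eq_single 0 (by simp +contextual)]; simp
  simp_rw [h2] at h
  simp only [map_one, mul_one] at h
  rw [← h.tsum_eq, tsum_eq_single 0 (by simp +contextual)]; simp

lemma integral_norm_one_add_unitChar_pow (n : ℕ) :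
    ∫ x, ‖1 + unitChar x‖ ^ (2 * n) = (Nat.choose (2 * n) n : ℝ) := by
  have hs : Summable fun k => ‖((n.choose k : ℕ) : ℂ)‖ :=
    summable_of_ne_finset_zero (s := Finset.range (n + 1)) (by
      intro k hk
      rw [Nat.choose_eq_zero_of_lt (by simpa using hk)]; simp)
  have hf : ∀ x, ∑' k, ((n.choose k : ℕ) : ℂ) * unitChar x ^ k = (1 + unitChar x) ^ n := by
    intro x
    rw [tsum_eq_sum (s := Finset.range (n + 1)), add_comm 1 (unitChar x), add_pow]
    · exact Finset.sum_congr rfl fun k _ => by simp [mul_comm]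
    · intro k hk
      rw [Nat.choose_eq_zero_of_lt (by simpa using hk)]; simp
  have h := (hasSum_integral_mul_conj hs hs).tsum_eq
  simp_rw [hf, Complex.mul_conj'] at h
  rw [tsum_eq_sum (s := Finset.range (n + 1)) (by
      intro k hk
      rw [Nat.choose_eq_zero_of_lt (by simpa using hk)]; simp)] at h
  have h2 : ∀ x, ((‖(1 + unitChar x) ^ n‖ : ℂ) ^ 2) = ((‖1 + unitChar x‖ ^ (2 * n) : ℝ) : ℂ) := by
    intro x
    rw [norm_pow]; push_cast; ring
  simp_rw [h2, integral_complex_ofReal] at h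
  rw [← Nat.sum_range_choose_sq]
  push_cast
  apply Complex.ofReal_injective
  rw [← h]
  push_cast
  exact Finset.sum_congr rfl fun k _ => by simp [sq]

lemma hasSum_choose_mul_pow (a : ℂ) {z : ℂ} (hz : ‖z‖ < 1) :
    HasSum (fun k => Ring.choose a k * z ^ k) ((1 + z) ^ a) := by
  have h := (Complex.one_add_cpow_hasFPowerSeriesOnBall_zero (a := a)).hasSum (y := z) (by
    rw [← ENNReal.ofReal_one, Metric.eball_ofReal]; simpa using hz)
  simpa [binomialSeries, FormalMultilinearSeries.coeff_ofScalars, mul_comm] using h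

lemma summable_norm_choose_mul_pow (a : ℂ) {z : ℂ} (hz : ‖z‖ < 1) :
    Summable fun k => ‖Ring.choose a k * z ^ k‖ := by
  have h := (binomialSeries ℂ a).summable_norm_apply (x := z)
    (Metric.eball_subset_eball (binomialSeries_radius_ge_one (a := a)) (by
      rw [← ENNReal.ofReal_one, Metric.eball_ofReal]; simpa using hz))
  simpa [binomialSeries, FormalMultilinearSeries.coeff_ofScalars, mul_comm] using h

lemma one_add_ne_zero_of_norm_lt_one {z : ℂ} (hz : ‖z‖ < 1) : 1 + z ≠ 0 :=
  Complex.slitPlane_ne_zero (Complex.mem_slitPlane_of_norm_lt_one hz)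

lemma norm_cpow_eq_mul_conj {z : ℂ} (hz : z ≠ 0) (s : ℂ) :
    (‖z‖ : ℂ) ^ s = z ^ (s / 2) * (starRingEnd ℂ) (z ^ (starRingEnd ℂ) (s / 2)) := by
  rw [Complex.cpow_def_of_ne_zero (by simpa using hz), Complex.cpow_def_of_ne_zero hz,
    Complex.cpow_def_of_ne_zero hz, ← Complex.exp_conj, ← Complex.exp_add, map_mul,
    Complex.conj_conj, ← add_mul, Complex.add_conj, Complex.log_re, ← Complex.ofReal_log (by positivity)]
  push_cast
  ring_nf

lemma integral_norm_one_add_cpow (s : ℂ) {w : ℂ} (hw : ‖w‖ < 1) :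
    ∫ x, (‖1 + w * unitChar x‖ : ℂ) ^ s = ∑' k, Ring.choose (s / 2) k ^ 2 * (‖w‖ : ℂ) ^ (2 * k) := by
  have hx : ∀ x, ‖w * unitChar x‖ < 1 := fun x => by simpa [norm_unitChar] using hw
  have h := hasSum_integral_mul_conj (summable_norm_choose_mul_pow (s / 2) hw)
    (summable_norm_choose_mul_pow ((starRingEnd ℂ) (s / 2)) hw)
  have e : ∀ a x, ∑' k, Ring.choose a k * w ^ k * unitChar x ^ k = (1 + w * unitChar x) ^ a :=
    fun a x => by
      simp_rw [mul_assoc, ← mul_pow]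
      exact (hasSum_choose_mul_pow a (hx x)).tsum_eq
  simp_rw [e, ← norm_cpow_eq_mul_conj (one_add_ne_zero_of_norm_lt_one (hx _))] at h
  rw [← h.tsum_eq]
  congr 1
  ext k
  rw [map_mul, Ring.map_choose, Complex.conj_conj, map_pow, pow_mul, ← Complex.mul_conj']
  ring

/-- The real harmonic number `1 + 1/2 + ⋯ + 1/n`. -/
noncomputable def harmonicSum (n : ℕ) : ℝ := ∑ j ∈ Finset.range n, 1 / ((j : ℝ) + 1)

/-- The sum of `1 / (i j)` over `i + j = n` with `i, j` positive. -/
noncomputable def reciprocalConv (n : ℕ) : ℝ :=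
  ∑ p ∈ Finset.HasAntidiagonal.antidiagonal n, 1 / (p.1 : ℝ) * (1 / (p.2 : ℝ))

lemma reciprocalConv_zero : reciprocalConv 0 = 0 := by simp [reciprocalConv]

lemma reciprocalConv_succ (n : ℕ) :
    reciprocalConv (n + 1) = 2 * harmonicSum n / (n + 1) := by
  have h1 : reciprocalConv (n + 1) =
      ∑ j ∈ Finset.range n, 1 / ((j : ℝ) + 1) * (1 / ((n - j : ℕ) : ℝ)) := by
    rw [reciprocalConv, Finset.Nat.sum_antidiagonal_eq_sum_range_succ_mk, Finset.sum_range_succ',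
      Finset.sum_range_succ]
    simp
  have h2 : ∑ j ∈ Finset.range n, 1 / ((n - j : ℕ) : ℝ) = harmonicSum n := by
    rw [harmonicSum, ← Finset.sum_range_reflect]
    refine Finset.sum_congr rfl fun j hj => ?_
    have : j < n := by simpa using hj
    rw [show n - (n - 1 - j) = j + 1 by omega]; push_cast; rfl
  rw [h1, two_mul]
  nth_rewrite 1 [← h2]
  rw [harmonicSum, ← Finset.sum_add_distrib, Finset.sum_div]
  refine Finset.sum_congr rfl fun j hj => ?_
  have hj : j < n := by simpa using hj
  have h3 : ((n - j : ℕ) : ℝ) ≠ 0 := by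
    have : n - j ≠ 0 := by omega
    exact_mod_cast this
  have h4 : (n : ℝ) = (n - j : ℕ) + j := by
    rw [Nat.cast_sub hj.le]; ring
  rw [h4]
  have h5 : (((n - j : ℕ) : ℝ) + j + 1) ≠ 0 := by positivity
  field_simp
  ring

/-- The coefficients of the Taylor series of `z ↦ log (1 + w z)`. -/
noncomputable def logCoeff (w : ℂ) (k : ℕ) : ℂ := (-1) ^ (k + 1) * w ^ k / k

lemma logCoeff_zero (w : ℂ) : logCoeff w 0 = 0 := by simp [logCoeff]

lemma norm_logCoeff_le (w : ℂ) (k : ℕ) : ‖logCoeff w k‖ ≤ ‖w‖ ^ k := by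
  rcases k.eq_zero_or_pos with rfl | hk
  · simp [logCoeff_zero]
  · have : (1 : ℝ) ≤ k := by exact_mod_cast hk
    simp only [logCoeff, norm_div, norm_mul, norm_pow, norm_neg, norm_one, one_pow, one_mul,
      Complex.norm_natCast]
    exact div_le_self (by positivity) this

lemma summable_norm_logCoeff {w : ℂ} (hw : ‖w‖ < 1) : Summable fun k => ‖logCoeff w k‖ :=
  (summable_geometric_of_lt_one (norm_nonneg _) hw).of_nonneg_of_le (fun _ => norm_nonneg _)
    (norm_logCoeff_le w)

lemma tsum_logCoeff {w z : ℂ} (h : ‖w * z‖ < 1) :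
    ∑' k, logCoeff w k * z ^ k = Complex.log (1 + w * z) := by
  rw [← (Complex.hasSum_taylorSeries_log h).tsum_eq]
  congr 1; ext k; simp only [logCoeff, mul_pow]; ring

lemma sum_logCoeff_mul (w : ℂ) (n : ℕ) :
    ∑ p ∈ Finset.HasAntidiagonal.antidiagonal n, logCoeff w p.1 * logCoeff w p.2
      = (-1) ^ n * w ^ n * (reciprocalConv n : ℂ) := by
  simp only [reciprocalConv, Complex.ofReal_sum, Finset.mul_sum]
  refine Finset.sum_congr rfl fun p hp => ?_
  rw [← Finset.HasAntidiagonal.mem_antidiagonal.mp hp]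
  simp only [logCoeff]
  push_cast
  ring

lemma tsum_sum_mul_pow {R : Type*} [NormedCommRing R] [CompleteSpace R] [NormOneClass R]
    {a b : ℕ → R} {z : R}
    (ha : Summable fun k => ‖a k‖) (hb : Summable fun k => ‖b k‖) (hz : ‖z‖ ≤ 1) :
    ∑' n, (∑ p ∈ Finset.HasAntidiagonal.antidiagonal n, a p.1 * b p.2) * z ^ n
      = (∑' k, a k * z ^ k) * ∑' k, b k * z ^ k := by
  have h : ∀ u : ℕ → R, Summable (fun k => ‖u k‖) → Summable fun k => ‖u k * z ^ k‖ := by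
    intro u hu
    refine hu.of_nonneg_of_le (fun _ => norm_nonneg _) fun k => (norm_mul_le _ _).trans ?_
    exact mul_le_of_le_one_right (norm_nonneg _) ((norm_pow_le z k).trans
      (pow_le_one₀ (norm_nonneg _) hz))
  rw [tsum_mul_tsum_eq_tsum_sum_antidiagonal_of_summable_norm (h a ha) (h b hb)]
  congr 1; ext n
  rw [Finset.sum_mul]
  refine Finset.sum_congr rfl fun p hp => ?_
  rw [← Finset.HasAntidiagonal.mem_antidiagonal.mp hp, pow_add]; ring

section LogAverages
variable {w : ℂ} (hw : ‖w‖ < 1)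
include hw

lemma norm_mul_unitChar_lt (x : UnitAddCircle) : ‖w * unitChar x‖ < 1 := by
  simpa [norm_unitChar] using hw

lemma continuous_log_one_add_unitChar : Continuous fun x => Complex.log (1 + w * unitChar x) := by
  have := continuous_unitChar
  exact Continuous.clog (by fun_prop)
    fun x => Complex.mem_slitPlane_of_norm_lt_one (norm_mul_unitChar_lt hw x)

lemma integral_log_norm_one_add : ∫ x, Real.log ‖1 + w * unitChar x‖ = 0 := by
  have h := integral_tsum_unitChar (summable_norm_logCoeff hw)
  simp_rw [tsum_logCoeff (norm_mul_unitChar_lt hw _), logCoeff_zero] at h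
  simp_rw [← Complex.log_re]
  have h2 := integral_re (𝕜 := ℂ) (integrable_of_continuous_unitAddCircle (continuous_log_one_add_unitChar hw))
  simp only [RCLike.re_to_complex] at h2
  rw [h2, h, Complex.zero_re]

lemma tsum_logCoeff_sq (x : UnitAddCircle) :
    ∑' n, (∑ p ∈ Finset.HasAntidiagonal.antidiagonal n, logCoeff w p.1 * logCoeff w p.2) * unitChar x ^ n
      = Complex.log (1 + w * unitChar x) ^ 2 := by
  rw [tsum_sum_mul_pow (summable_norm_logCoeff hw) (summable_norm_logCoeff hw)
    (norm_unitChar x).le, tsum_logCoeff (norm_mul_unitChar_lt hw _), sq]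

lemma integral_log_sq : ∫ x, Complex.log (1 + w * unitChar x) ^ 2 = 0 := by
  have h := integral_tsum_unitChar (summable_norm_sum_mul_antidiagonal_of_summable_norm
    (summable_norm_logCoeff hw) (summable_norm_logCoeff hw))
  simpa [tsum_logCoeff_sq hw, logCoeff_zero] using h

lemma integral_log_cube : ∫ x, Complex.log (1 + w * unitChar x) ^ 3 = 0 := by
  have hs := summable_norm_sum_mul_antidiagonal_of_summable_norm
    (summable_norm_logCoeff hw) (summable_norm_logCoeff hw)
  have h := integral_tsum_unitChar (summable_norm_sum_mul_antidiagonal_of_summable_norm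
    hs (summable_norm_logCoeff hw))
  simp_rw [tsum_sum_mul_pow hs (summable_norm_logCoeff hw) (norm_unitChar _).le,
    tsum_logCoeff_sq hw, tsum_logCoeff (norm_mul_unitChar_lt hw _), ← pow_succ] at h
  simpa [logCoeff_zero] using h

lemma integral_log_norm_one_add_sq :
    ∫ x, Real.log ‖1 + w * unitChar x‖ ^ 2 = ∑' k : ℕ, 1 / 2 * (1 / (k : ℝ) ^ 2) * ‖w‖ ^ (2 * k) := by
  have hc := continuous_log_one_add_unitChar hw
  have h := (hasSum_integral_mul_conj (summable_norm_logCoeff hw) (summable_norm_logCoeff hw)).tsum_eq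
  simp_rw [tsum_logCoeff (norm_mul_unitChar_lt hw _)] at h
  have e : ∀ z : ℂ, z.re ^ 2 = (1 / 2 * (z * (starRingEnd ℂ) z + z ^ 2)).re := by
    intro z; simp [sq]; ring
  have h2 := integral_re (𝕜 := ℂ) (integrable_of_continuous_unitAddCircle
    (f := fun x => 1 / 2 * (Complex.log (1 + w * unitChar x) *
      (starRingEnd ℂ) (Complex.log (1 + w * unitChar x)) + Complex.log (1 + w * unitChar x) ^ 2))
      (by fun_prop))
  simp only [RCLike.re_to_complex] at h2
  simp_rw [← Complex.log_re, e, h2]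
  rw [integral_const_mul, integral_add (integrable_of_continuous_unitAddCircle (by fun_prop))
    (integrable_of_continuous_unitAddCircle (by fun_prop)), integral_log_sq hw, ← h, add_zero,
    ← tsum_mul_left]
  have e2 : ∀ k, 1 / 2 * (logCoeff w k * (starRingEnd ℂ) (logCoeff w k))
      = ((1 / 2 * (1 / (k : ℝ) ^ 2) * ‖w‖ ^ (2 * k) : ℝ) : ℂ) := by
    intro k
    rw [Complex.mul_conj']
    simp [logCoeff, div_pow, pow_mul]
    ring
  simp_rw [e2]
  rw [← Complex.ofReal_tsum, Complex.ofReal_re]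

lemma integral_log_norm_one_add_cube :
    ∫ x, Real.log ‖1 + w * unitChar x‖ ^ 3
      = ∑' k : ℕ, -(3 / 4) * (reciprocalConv k / k) * ‖w‖ ^ (2 * k) := by
  have hc := continuous_log_one_add_unitChar hw
  have h := (hasSum_integral_mul_conj (summable_norm_sum_mul_antidiagonal_of_summable_norm
    (summable_norm_logCoeff hw) (summable_norm_logCoeff hw)) (summable_norm_logCoeff hw)).tsum_eq
  simp_rw [tsum_logCoeff (norm_mul_unitChar_lt hw _), tsum_logCoeff_sq hw] at h
  have e : ∀ z : ℂ, z.re ^ 3 = (3 / 4 * (z ^ 2 * (starRingEnd ℂ) z) + 1 / 4 * z ^ 3).re := by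
    intro z; simp [pow_succ]; ring
  have h2 := integral_re (𝕜 := ℂ) (integrable_of_continuous_unitAddCircle
    (f := fun x => 3 / 4 * (Complex.log (1 + w * unitChar x) ^ 2 *
      (starRingEnd ℂ) (Complex.log (1 + w * unitChar x)))
        + 1 / 4 * Complex.log (1 + w * unitChar x) ^ 3)
      (by fun_prop))
  simp only [RCLike.re_to_complex] at h2
  simp_rw [← Complex.log_re, e, h2]
  rw [integral_add (integrable_of_continuous_unitAddCircle (by fun_prop))
    (integrable_of_continuous_unitAddCircle (by fun_prop)), integral_const_mul, integral_const_mul,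
    integral_log_cube hw, ← h, mul_zero, add_zero, ← tsum_mul_left]
  have e2 : ∀ k, 3 / 4 * ((∑ p ∈ Finset.HasAntidiagonal.antidiagonal k, logCoeff w p.1 * logCoeff w p.2) *
      (starRingEnd ℂ) (logCoeff w k))
      = ((-(3 / 4) * (reciprocalConv k / k) * ‖w‖ ^ (2 * k) : ℝ) : ℂ) := by
    intro k
    rw [sum_logCoeff_mul]
    have h1 : ((-1 : ℂ)) ^ k * (-1) ^ k = 1 := by rw [← mul_pow]; simp
    have h3 : w ^ k * (starRingEnd ℂ) w ^ k = (‖w‖ : ℂ) ^ (2 * k) := by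
      rw [← mul_pow, Complex.mul_conj', ← pow_mul]
    simp only [logCoeff, map_div₀, map_mul, map_pow, map_neg, map_one, Complex.conj_natCast]
    push_cast
    rw [← h3]
    linear_combination (-(3 / 4) * (reciprocalConv k / k) * (w ^ k * (starRingEnd ℂ) w ^ k) : ℂ) * h1
  simp_rw [e2]
  rw [← Complex.ofReal_tsum, Complex.ofReal_re]

end LogAverages

lemma measurePreserving_unitTorus :
    MeasurePreserving (fun θ : Fin 2 → ℝ => (((θ 1 : UnitAddCircle) - (θ 0 : UnitAddCircle)),
      (θ 0 : UnitAddCircle))) (volume.restrict (Set.Icc 0 1))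
      ((volume : Measure UnitAddCircle).prod volume) := by
  have h1 : (volume : Measure (Fin 2 → ℝ)).restrict (Set.Icc 0 1)
      = Measure.pi fun _ => volume.restrict (Set.Ioc (0 : ℝ) (0 + 1)) := by
    rw [← Measure.restrict_pi_pi, ← volume_pi]
    refine Measure.restrict_congr_set ?_
    have h := (Measure.univ_pi_Ioc_ae_eq_Icc (μ := fun _ : Fin 2 => (volume : Measure ℝ))
      (f := fun _ => 0) (g := fun _ => 1)).symm
    simp only [zero_add]
    exact h
  have h2 : MeasurePreserving (fun (θ : Fin 2 → ℝ) i => (θ i : UnitAddCircle))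
      (volume.restrict (Set.Icc 0 1)) (Measure.pi fun _ => volume) := by
    rw [h1]
    exact measurePreserving_pi _ _ fun i => UnitAddCircle.measurePreserving_mk 0
  have h3 := measurePreserving_finTwoArrow (volume : Measure UnitAddCircle)
  have h4 := measurePreserving_prod_neg_add (volume : Measure UnitAddCircle)
    (volume : Measure UnitAddCircle)
  have h5 := (Measure.measurePreserving_swap.comp h4).comp (h3.comp h2)
  convert h5 using 1
  ext θ
  · simp [MeasurableEquiv.finTwoArrow, sub_eq_add_neg, add_comm]
  · simp [MeasurableEquiv.finTwoArrow]

lemma norm_torusEval_polyXYC (c : ℝ) (θ : Fin 2 → ℝ) :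
    ‖torusEval (polyXYC c) θ‖ = ‖(c : ℂ) + (1 + unitChar ((θ 1 : UnitAddCircle) - θ 0)) *
      unitChar (θ 0 : UnitAddCircle)‖ := by
  rw [add_mul, ← unitChar_add, sub_add_cancel, unitChar_coe, unitChar_coe]
  simp only [torusEval, polyXYC, map_add, MvPolynomial.eval_X, MvPolynomial.eval_C]
  ring_nf

/-- The modulus of `x + y + c` in the torus coordinates `y / x` and `x`. -/
noncomputable def fiberNorm (c : ℝ) (p : UnitAddCircle × UnitAddCircle) : ℝ :=
  ‖(c : ℂ) + (1 + unitChar p.1) * unitChar p.2‖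

lemma continuous_fiberNorm (c : ℝ) : Continuous (fiberNorm c) := by
  have := continuous_unitChar
  unfold fiberNorm
  fun_prop

section Torus
variable {E : Type*} [NormedAddCommGroup E]

lemma integrableOn_torusEval_iff {F : ℝ → E} (hF : StronglyMeasurable F) (c : ℝ) :
    IntegrableOn (fun θ => F ‖torusEval (polyXYC c) θ‖) (Set.Icc 0 1) ↔
      Integrable (fun p => F (fiberNorm c p))
        ((volume : Measure UnitAddCircle).prod volume) := by
  simp_rw [norm_torusEval_polyXYC]
  exact measurePreserving_unitTorus.integrable_comp
    (hF.comp_measurable (continuous_fiberNorm c).measurable).aestronglyMeasurable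

lemma integral_torusEval [NormedSpace ℝ E] {F : ℝ → E} (hF : StronglyMeasurable F) (c : ℝ) :
    ∫ θ in Set.Icc (0 : Fin 2 → ℝ) 1, F ‖torusEval (polyXYC c) θ‖ =
      ∫ p, F (fiberNorm c p) ∂((volume : Measure UnitAddCircle).prod volume) := by
  simp_rw [norm_torusEval_polyXYC]
  rw [← measurePreserving_unitTorus.map_eq]
  exact (integral_map measurePreserving_unitTorus.measurable.aemeasurable
    (hF.comp_measurable (continuous_fiberNorm c).measurable).aestronglyMeasurable).symm

end Torus

lemma norm_one_add_unitChar_le (a : UnitAddCircle) : ‖1 + unitChar a‖ ≤ 2 :=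
  (norm_add_le _ _).trans (by rw [norm_unitChar]; norm_num)

lemma ae_norm_one_add_unitChar_lt : ∀ᵐ a : UnitAddCircle, ‖1 + unitChar a‖ < 2 := by
  have h : ∀ᵐ a : UnitAddCircle, a ≠ 0 := by
    have h0 := AddCircle.volume_closedBall 1 (x := (0 : UnitAddCircle)) 0
    rw [Metric.closedBall_zero] at h0
    simpa using measure_eq_zero_iff_ae_notMem.1 (h0.trans (by simp))
  filter_upwards [h] with a ha
  refine (norm_one_add_unitChar_le a).lt_of_ne fun h2 => ha ?_
  have h3 : SameRay ℝ 1 (unitChar a) := sameRay_iff_norm_add.2 (by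
    rw [h2, norm_unitChar]; norm_num)
  have h4 := h3.norm_smul_eq
  simp only [norm_unitChar, norm_one, one_smul] at h4
  refine AddCircle.injective_toCircle one_ne_zero ?_
  rw [AddCircle.toCircle_zero]
  exact Subtype.ext (h4.trans Circle.coe_one.symm)

section Outer
variable {E : Type*} [NormedAddCommGroup E] [NormedSpace ℝ E] {A : ℕ → E}

lemma summable_integral_norm_outer (hA : Summable fun k => (Nat.choose (2 * k) k : ℝ) * ‖A k‖) :
    Summable fun k => ∫ b, ‖‖1 + unitChar b‖ ^ (2 * k) • A k‖ := by
  refine hA.congr fun k => ?_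
  simp_rw [norm_smul, norm_pow, norm_norm]
  rw [integral_mul_const, integral_norm_one_add_unitChar_pow]

lemma integrable_outer_term (k : ℕ) : Integrable fun b => ‖1 + unitChar b‖ ^ (2 * k) • A k := by
  have := continuous_unitChar
  exact integrable_of_continuous_unitAddCircle (by fun_prop)

lemma hasSum_integral_outer [CompleteSpace E]
    (hA : Summable fun k => (Nat.choose (2 * k) k : ℝ) * ‖A k‖) :
    HasSum (fun k => (Nat.choose (2 * k) k : ℝ) • A k)
      (∫ b, ∑' k, ‖1 + unitChar b‖ ^ (2 * k) • A k) := by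
  have h := hasSum_integral_of_summable_integral_norm (fun k => integrable_outer_term (A := A) k)
    (summable_integral_norm_outer hA)
  simpa only [integral_smul_const, integral_norm_one_add_unitChar_pow] using h

lemma integrable_of_ae_eq_outer {f : UnitAddCircle → E} (hf : AEStronglyMeasurable f)
    (hA : Summable fun k => (Nat.choose (2 * k) k : ℝ) * ‖A k‖)
    (h : ∀ᵐ b, f b = ∑' k, ‖1 + unitChar b‖ ^ (2 * k) • A k) : Integrable f := by
  refine ⟨hf, ?_⟩
  have hs := summable_integral_norm_outer hA
  calc ∫⁻ b, ‖f b‖ₑ ≤ ∫⁻ b, ∑' k, ‖‖1 + unitChar b‖ ^ (2 * k) • A k‖ₑ := by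
        refine lintegral_mono_ae ?_
        filter_upwards [h] with b hb
        rw [hb]
        exact enorm_tsum_le_tsum_enorm
    _ = ∑' k, ∫⁻ b, ‖‖1 + unitChar b‖ ^ (2 * k) • A k‖ₑ :=
        lintegral_tsum fun k => (integrable_outer_term k).1.enorm
    _ = ∑' k, ENNReal.ofReal (∫ b, ‖‖1 + unitChar b‖ ^ (2 * k) • A k‖) := by
        congr 1; ext k
        exact (ofReal_integral_norm_eq_lintegral_enorm (integrable_outer_term k)).symm
    _ < ⊤ := by
        rw [← ENNReal.ofReal_tsum_of_nonneg (fun k => integral_nonneg fun _ => norm_nonneg _) hs]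
        exact ENNReal.ofReal_lt_top

end Outer

lemma fiberNorm_eq {c : ℝ} (hc : 0 < c) (b a : UnitAddCircle) :
    fiberNorm c (b, a) = c * ‖1 + (1 + unitChar b) / c * unitChar a‖ := by
  have hc' : (c : ℂ) ≠ 0 := by exact_mod_cast hc.ne'
  have : (c : ℂ) + (1 + unitChar b) * unitChar a
      = c * (1 + (1 + unitChar b) / c * unitChar a) := by field_simp
  rw [fiberNorm, this, norm_mul, Complex.norm_real, Real.norm_of_nonneg hc.le]

lemma norm_one_add_unitChar_div_lt {c : ℝ} (hc : 2 ≤ c) {b : UnitAddCircle}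
    (hb : ‖1 + unitChar b‖ < 2) : ‖(1 + unitChar b) / (c : ℂ)‖ < 1 := by
  have : 0 < c := by linarith
  rw [norm_div, Complex.norm_real, Real.norm_of_nonneg this.le, div_lt_one this]
  linarith

lemma fiberNorm_pos {c : ℝ} (hc : 2 ≤ c) {b : UnitAddCircle} (hb : ‖1 + unitChar b‖ < 2)
    (a : UnitAddCircle) : 0 < fiberNorm c (b, a) := by
  rw [fiberNorm_eq (by linarith)]
  exact mul_pos (by linarith) (norm_pos_iff.2 (one_add_ne_zero_of_norm_lt_one
    (norm_mul_unitChar_lt (norm_one_add_unitChar_div_lt hc hb) a)))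

section TorusAverage
variable {E : Type*} [NormedAddCommGroup E] {F : ℝ → E} {c : ℝ}

lemma integral_torus_eq_tsum [NormedSpace ℝ E] [CompleteSpace E] (hF : StronglyMeasurable F) (hc : 2 ≤ c) {A : ℕ → E}
    (hA : Summable fun k => (Nat.choose (2 * k) k : ℝ) * ‖A k‖)
    (hi : IntegrableOn (fun θ => F ‖torusEval (polyXYC c) θ‖) (Set.Icc 0 1))
    (hinner : ∀ w : ℂ, ‖w‖ < 1 → ∫ a, F (c * ‖1 + w * unitChar a‖) =
      ∑' k, (c * ‖w‖) ^ (2 * k) • A k) :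
    ∫ θ in Set.Icc (0 : Fin 2 → ℝ) 1, F ‖torusEval (polyXYC c) θ‖
      = ∑' k, (Nat.choose (2 * k) k : ℝ) • A k := by
  have hc0 : 0 < c := by linarith
  rw [integrableOn_torusEval_iff hF] at hi
  rw [integral_torusEval hF, integral_prod _ hi, (hasSum_integral_outer hA).tsum_eq]
  refine integral_congr_ae ?_
  filter_upwards [ae_norm_one_add_unitChar_lt] with b hb
  simp_rw [fiberNorm_eq hc0]
  rw [hinner _ (norm_one_add_unitChar_div_lt hc hb), norm_div, Complex.norm_real,
    Real.norm_of_nonneg hc0.le, mul_div_cancel₀ _ hc0.ne']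

lemma integrableOn_torus (hF : StronglyMeasurable F) (hFc : ContinuousOn F (Set.Ioi 0))
    (hc : 2 ≤ c) {A : ℕ → ℝ}
    (hA : Summable fun k => (Nat.choose (2 * k) k : ℝ) * ‖A k‖)
    (hinner : ∀ w : ℂ, ‖w‖ < 1 → ∫ a, ‖F (c * ‖1 + w * unitChar a‖)‖ =
      ∑' k, (c * ‖w‖) ^ (2 * k) • A k) :
    IntegrableOn (fun θ => F ‖torusEval (polyXYC c) θ‖) (Set.Icc 0 1) := by
  have hc0 : 0 < c := by linarith
  have hm : StronglyMeasurable fun p => F (fiberNorm c p) :=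
    hF.comp_measurable (continuous_fiberNorm c).measurable
  rw [integrableOn_torusEval_iff hF, integrable_prod_iff hm.aestronglyMeasurable]
  constructor
  · filter_upwards [ae_norm_one_add_unitChar_lt] with b hb
    refine integrable_of_continuous_unitAddCircle ?_
    exact hFc.comp_continuous ((continuous_fiberNorm c).comp (by fun_prop))
      fun a => fiberNorm_pos hc hb a
  · refine integrable_of_ae_eq_outer hm.norm.integral_prod_right.aestronglyMeasurable hA ?_
    filter_upwards [ae_norm_one_add_unitChar_lt] with b hb
    simp_rw [fiberNorm_eq hc0]
    rw [hinner _ (norm_one_add_unitChar_div_lt hc hb), norm_div, Complex.norm_real,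
      Real.norm_of_nonneg hc0.le, mul_div_cancel₀ _ hc0.ne']

end TorusAverage

lemma summable_of_eventually_mul_le_sub {a : ℕ → ℝ} (ha : ∀ n, 0 ≤ a n) {ε : ℝ} (hε : 0 < ε)
    {N : ℕ} (h : ∀ n ≥ N, ε * a n ≤ n * a n - (n + 1) * a (n + 1)) : Summable a := by
  rw [← summable_nat_add_iff N, ← summable_mul_left_iff hε.ne']
  have key : ∀ n, ∑ i ∈ Finset.range n, ε * a (i + N) ≤ N * a N - ((n + N : ℕ) : ℝ) * a (n + N) := by
    intro n
    induction n with
    | zero => simp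
    | succ n ih =>
      rw [Finset.sum_range_succ]
      have h1 := h (n + N) (by omega)
      rw [show n + 1 + N = n + N + 1 by omega]
      push_cast at *
      linarith
  refine summable_of_sum_range_le (c := N * a N) (fun n => mul_nonneg hε.le (ha _)) fun n => ?_
  exact (key n).trans (sub_le_self _ (mul_nonneg (Nat.cast_nonneg _) (ha _)))

lemma choose_succ_eq (z : ℂ) (k : ℕ) :
    Ring.choose z (k + 1) = Ring.choose z k * ((z - k) / (k + 1)) := by
  have h : ((k : ℂ) + 1) ≠ 0 := by exact_mod_cast k.succ_ne_zero
  have h2 : (k.factorial : ℂ) ≠ 0 := by exact_mod_cast k.factorial_ne_zero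
  rw [Ring.choose_eq_smul, Ring.choose_eq_smul, descPochhammer_succ_right, Polynomial.smeval_mul,
    Nat.factorial_succ]
  simp only [Polynomial.smeval_sub, Polynomial.smeval_X, Polynomial.smeval_natCast, smul_eq_mul]
  push_cast
  field_simp
  simp

lemma choose_two_mul_succ (k : ℕ) : (Nat.choose (2 * (k + 1)) (k + 1) : ℝ)
    = Nat.choose (2 * k) k * (2 * (2 * k + 1) / (k + 1)) := by
  have h := Nat.succ_mul_centralBinom_succ k
  simp only [Nat.centralBinom] at h
  have h2 : ((k : ℝ) + 1) ≠ 0 := by positivity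
  field_simp
  have h3 : (((k + 1) * (2 * (k + 1)).choose (k + 1) : ℕ) : ℝ) =
    ((2 * (2 * k + 1) * (2 * k).choose k : ℕ) : ℝ) := by rw [h]
  push_cast at h3
  linarith

lemma choose_two_mul_le (k : ℕ) : (Nat.choose (2 * k) k : ℝ) ≤ 4 ^ k := by
  have h := Nat.sum_range_choose (2 * k)
  have h2 : (2 * k).choose k ≤ 2 ^ (2 * k) := by
    rw [← h]
    exact Finset.single_le_sum (f := fun m => (2 * k).choose m) (fun _ _ => Nat.zero_le _)
      (Finset.mem_range.2 (by omega))
  rw [pow_mul] at h2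
  exact_mod_cast h2

lemma choose_two_mul_div_le {c : ℝ} (hc : 2 ≤ c) (k : ℕ) :
    (Nat.choose (2 * k) k : ℝ) / c ^ (2 * k) ≤ 1 := by
  have : 0 < c := by linarith
  rw [div_le_one (by positivity)]
  refine (choose_two_mul_le k).trans ?_
  rw [pow_mul]
  exact pow_le_pow_left₀ (by norm_num) (by nlinarith) _

lemma summable_choose_sq_of_two {z : ℂ} (hz : -(3 / 4) < z.re) :
    Summable fun k => (Nat.choose (2 * k) k : ℝ) * (‖Ring.choose z k‖ ^ 2 / 2 ^ (2 * k)) := by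
  set x := z.re
  set R := ‖z‖ ^ 2
  have hR : 0 ≤ R := by positivity
  set ε := (3 + 4 * x) / 4 with hε
  have hε0 : 0 < ε := by rw [hε]; linarith
  obtain ⟨N, hN⟩ := exists_nat_gt ((2 * R + 2 * |x| + 4 * ε + (R + 2 * ε)) / (2 * ε) + 1)
  refine summable_of_eventually_mul_le_sub (fun n => by positivity) hε0 (N := N) fun k hk => ?_
  have hkN : (N : ℝ) ≤ k := by exact_mod_cast hk
  have hn : ‖z - k‖ ^ 2 = (k : ℝ) ^ 2 - 2 * k * x + R := by
    simp only [R, x, Complex.sq_norm, Complex.normSq_apply]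
    simp
    ring
  have e : (Nat.choose (2 * (k + 1)) (k + 1) : ℝ) *
      (‖Ring.choose z (k + 1)‖ ^ 2 / 2 ^ (2 * (k + 1)))
      = (Nat.choose (2 * k) k : ℝ) * (‖Ring.choose z k‖ ^ 2 / 2 ^ (2 * k)) *
        (((k : ℝ) ^ 2 - 2 * k * x + R) * (2 * k + 1) / (2 * (k + 1) ^ 3)) := by
    rw [choose_succ_eq, choose_two_mul_succ, norm_mul, norm_div, mul_pow, div_pow, hn,
      show ‖((k : ℂ) + 1)‖ = (k : ℝ) + 1 by
        rw [← Nat.cast_succ, Complex.norm_natCast]; push_cast; rfl, mul_add 2 k 1, pow_add]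
    field_simp
    ring
  rw [e]
  set a := (Nat.choose (2 * k) k : ℝ) * (‖Ring.choose z k‖ ^ 2 / 2 ^ (2 * k))
  have ha : 0 ≤ a := by positivity
  have hk1 : (1 : ℝ) ≤ k := by
    have : 0 ≤ (2 * R + 2 * |x| + 4 * ε + (R + 2 * ε)) / (2 * ε) := by positivity
    linarith
  have hM : 2 * R + 2 * |x| + 4 * ε + (R + 2 * ε) ≤ k * (2 * ε) := by
    rw [← div_le_iff₀ (by positivity)]; linarith
  have hkey : ((k : ℝ) ^ 2 - 2 * k * x + R) * (2 * k + 1) ≤ 2 * (k - ε) * (k + 1) ^ 2 := by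
    have hx : x = ε - 3 / 4 := by rw [hε]; ring
    have h1 := mul_le_mul_of_nonneg_left hM (by linarith : (0 : ℝ) ≤ k)
    have h2 := mul_le_mul_of_nonneg_right hk1 (by positivity : (0 : ℝ) ≤ R + 2 * ε)
    have h3 := mul_le_mul_of_nonneg_left (neg_abs_le x) (by linarith : (0 : ℝ) ≤ k)
    have h4 : 4 * x + 3 - 4 * ε = 0 := by rw [hx]; ring
    have h5 : (k : ℝ) ^ 2 * (4 * x + 3 - 4 * ε) = 0 := by rw [h4, mul_zero]
    nlinarith
  have h6 : ((k : ℝ) + 1) * (((k : ℝ) ^ 2 - 2 * k * x + R) * (2 * k + 1) / (2 * (k + 1) ^ 3))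
      ≤ k - ε := by
    have : (0 : ℝ) < k + 1 := by linarith
    rw [mul_div_assoc', div_le_iff₀ (by positivity)]
    nlinarith
  nlinarith

lemma summable_choose_sq {c : ℝ} (hc : 2 ≤ c) {s : ℂ} (hs : 2 < c ∨ -(3 / 2 : ℝ) < s.re) :
    Summable fun k => (Nat.choose (2 * k) k : ℝ) * (‖Ring.choose (s / 2) k‖ ^ 2 / c ^ (2 * k)) := by
  rcases hc.eq_or_lt with rfl | hc2
  · refine summable_choose_sq_of_two ?_
    have h := hs.resolve_left (lt_irrefl _)
    have : (s / 2).re = s.re / 2 := by simp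
    linarith
  · have hc0 : 0 < c := by linarith
    have hr : ‖((2 / c : ℝ) : ℂ)‖ < 1 := by
      rw [Complex.norm_real, Real.norm_of_nonneg (by positivity), div_lt_one hc0]; exact hc2
    have h := summable_norm_choose_mul_pow (s / 2) hr
    refine (hasSum_integral_mul_conj h h).summable.norm.of_nonneg_of_le
      (fun _ => by positivity) fun k => ?_
    rw [norm_mul, RCLike.norm_conj, norm_mul, norm_pow, Complex.norm_real,
      Real.norm_of_nonneg (by positivity)]
    have h4 : ‖Ring.choose (s / 2) k‖ * (2 / c) ^ k * (‖Ring.choose (s / 2) k‖ * (2 / c) ^ k)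
        = 4 ^ k * (‖Ring.choose (s / 2) k‖ ^ 2 / c ^ (2 * k)) := by
      rw [div_pow, show (4 : ℝ) ^ k = 2 ^ k * 2 ^ k by rw [← mul_pow]; norm_num, mul_comm 2 k,
        pow_mul, sq, sq]
      field_simp
    rw [h4]
    exact mul_le_mul_of_nonneg_right (choose_two_mul_le k) (by positivity)

lemma stronglyMeasurable_ofReal_cpow (s : ℂ) : StronglyMeasurable fun t : ℝ => (t : ℂ) ^ s :=
  (Complex.measurable_ofReal.pow_const s).stronglyMeasurable

section Zeta
variable {c : ℝ} (hc : 2 ≤ c) {s : ℂ}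
include hc

lemma integral_mul_norm_one_add_cpow (s : ℂ) {w : ℂ} (hw : ‖w‖ < 1) :
    ∫ a, ((c * ‖1 + w * unitChar a‖ : ℝ) : ℂ) ^ s = ∑' k, (c * ‖w‖) ^ (2 * k) •
      ((c : ℂ) ^ s * (Ring.choose (s / 2) k ^ 2 / (c : ℂ) ^ (2 * k))) := by
  have hc0 : 0 < c := by linarith
  have hc' : (c : ℂ) ≠ 0 := by exact_mod_cast hc0.ne'
  simp_rw [Complex.ofReal_mul, Complex.mul_cpow_ofReal_nonneg hc0.le (norm_nonneg _)]
  rw [integral_const_mul, integral_norm_one_add_cpow s hw, ← tsum_mul_left]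
  congr 1; ext k
  rw [Complex.real_smul]
  push_cast
  rw [mul_pow]
  field_simp

lemma summable_norm_zeta_coeff (hs : 2 < c ∨ -(3 / 2 : ℝ) < s.re) :
    Summable fun k => (Nat.choose (2 * k) k : ℝ) *
      ‖(c : ℂ) ^ s * (Ring.choose (s / 2) k ^ 2 / (c : ℂ) ^ (2 * k))‖ := by
  have hc0 : 0 < c := by linarith
  refine ((summable_choose_sq hc hs).mul_left ‖(c : ℂ) ^ s‖).congr fun k => ?_
  rw [norm_mul, norm_div, norm_pow, norm_pow, Complex.norm_real, Real.norm_of_nonneg hc0.le]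
  ring

lemma integrableOn_torusEval_cpow (hs : 2 < c ∨ -(3 / 2 : ℝ) < s.re) :
    IntegrableOn (fun θ : Fin 2 → ℝ => (‖torusEval (polyXYC c) θ‖ : ℂ) ^ s) (Set.Icc 0 1) := by
  have hc0 : 0 < c := by linarith
  have hA := summable_norm_zeta_coeff hc (s := (s.re : ℂ)) (by simpa using hs)
  have eA : ∀ k, (c : ℂ) ^ (s.re : ℂ) * (Ring.choose ((s.re : ℂ) / 2) k ^ 2 / (c : ℂ) ^ (2 * k))
      = ((c ^ s.re * (Ring.choose (s.re / 2) k ^ 2 / c ^ (2 * k)) : ℝ) : ℂ) := by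
    intro k
    push_cast
    rw [Complex.ofReal_cpow hc0.le]
  simp_rw [eA, Complex.norm_real] at hA
  refine integrableOn_torus (stronglyMeasurable_ofReal_cpow s) ?_ hc hA fun w hw => ?_
  · intro t ht
    have ht : (0 : ℝ) < t := ht
    refine ContinuousAt.continuousWithinAt ?_
    exact (Complex.continuousAt_ofReal_cpow_const t s (Or.inr ht.ne'))
  · have h := integral_mul_norm_one_add_cpow hc (s.re : ℂ) hw
    simp_rw [eA] at h
    have hp : ∀ a, 0 < c * ‖1 + w * unitChar a‖ := fun a => mul_pos hc0
      (norm_pos_iff.2 (one_add_ne_zero_of_norm_lt_one (norm_mul_unitChar_lt hw a)))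
    simp_rw [Complex.norm_cpow_eq_rpow_re_of_pos (hp _)]
    apply Complex.ofReal_injective
    rw [← integral_complex_ofReal, Complex.ofReal_tsum]
    simp_rw [Complex.ofReal_cpow (hp _).le, h]
    congr 1; ext k
    simp

lemma zetaMahler_polyXYC (hs : 2 < c ∨ -(3 / 2 : ℝ) < s.re) :
    zetaMahler s (polyXYC c) = (c : ℂ) ^ s * ∑' j : ℕ,
      Ring.choose (s / 2) j ^ 2 * (1 / (c : ℂ) ^ (2 * j)) * (Nat.choose (2 * j) j : ℂ) := by
  rw [zetaMahler, integral_torus_eq_tsum (stronglyMeasurable_ofReal_cpow s) hc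
    (summable_norm_zeta_coeff hc hs) (integrableOn_torusEval_cpow hc hs)
    fun w hw => integral_mul_norm_one_add_cpow hc s hw, ← tsum_mul_left]
  congr 1; ext k
  rw [Complex.real_smul]
  push_cast
  ring

lemma summable_zeta_terms (hs : 2 < c ∨ -(3 / 2 : ℝ) < s.re) :
    Summable (fun j : ℕ =>
      Ring.choose (s / 2) j ^ 2 * (1 / (c : ℂ) ^ (2 * j)) * (Nat.choose (2 * j) j : ℂ)) := by
  refine Summable.of_norm ((summable_choose_sq hc hs).congr fun k => ?_)
  have hc0 : 0 < c := by linarith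
  simp [abs_of_pos hc0]
  ring

end Zeta

lemma harmonicSum_nonneg (n : ℕ) : 0 ≤ harmonicSum n :=
  Finset.sum_nonneg fun _ _ => by positivity

lemma harmonicSum_eq_sum_Icc (n : ℕ) : ∑ j ∈ Finset.Icc 1 n, 1 / (j : ℝ) = harmonicSum n := by
  rw [harmonicSum, Finset.range_eq_Ico]
  simpa using! (Finset.sum_Ico_add' (fun j : ℕ => 1 / (j : ℝ)) 0 n 1).symm

lemma harmonicSum_le_sqrt (n : ℕ) : harmonicSum n ≤ 2 * √n := by
  induction n with
  | zero => simp [harmonicSum]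
  | succ n ih =>
    rw [harmonicSum, Finset.sum_range_succ, ← harmonicSum]
    have h1 : √(n : ℝ) ^ 2 = n := Real.sq_sqrt (by positivity)
    have h2 : √((n + 1 : ℕ) : ℝ) ^ 2 = n + 1 := by rw [Real.sq_sqrt (by positivity)]; push_cast; rfl
    set u := √(n : ℝ)
    set v := √((n + 1 : ℕ) : ℝ)
    have hu : 0 ≤ u := Real.sqrt_nonneg _
    have hv : 1 ≤ v := by
      rw [Real.one_le_sqrt]; push_cast; linarith [(Nat.cast_nonneg n : (0 : ℝ) ≤ n)]
    have h3 : 1 / ((n : ℝ) + 1) ≤ 2 * v - 2 * u := by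
      rw [← h2, div_le_iff₀ (by positivity)]
      have huv : u ≤ v := by nlinarith
      nlinarith [mul_nonneg (sub_nonneg.2 huv) (sub_nonneg.2 hv)]
    linarith

lemma summable_harmonicSum_div_sq : Summable fun n : ℕ => harmonicSum n / ((n : ℝ) + 1) ^ 2 := by
  have h := (summable_nat_add_iff 1).2 ((Real.summable_one_div_nat_rpow (p := 3 / 2)).2 (by norm_num))
  refine (h.mul_left 2).of_nonneg_of_le
    (fun n => div_nonneg (harmonicSum_nonneg n) (by positivity)) fun n => ?_
  have hn : (0 : ℝ) < n + 1 := by positivity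
  have h2 : ((n : ℝ) + 1) ^ (3 / 2 : ℝ) * √((n : ℝ) + 1) = (n + 1) ^ 2 := by
    rw [Real.sqrt_eq_rpow, ← Real.rpow_add hn, ← Real.rpow_natCast]; norm_num
  push_cast
  rw [← h2]
  have h3 : harmonicSum n ≤ 2 * √((n : ℝ) + 1) :=
    (harmonicSum_le_sqrt n).trans (by gcongr; linarith)
  rw [div_le_iff₀ (by positivity)]
  refine h3.trans_eq ?_
  field_simp

lemma summable_reciprocalConv_div : Summable fun k : ℕ => reciprocalConv k / k := by
  rw [← summable_nat_add_iff 1]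
  refine (summable_harmonicSum_div_sq.mul_left 2).congr fun n => ?_
  rw [reciprocalConv_succ]
  push_cast
  field_simp

lemma volume_Icc_fin_two : (volume : Measure (Fin 2 → ℝ)).real (Set.Icc 0 1) = 1 := by
  simp [Measure.real, Real.volume_Icc_pi]

section Log
variable {c : ℝ} (hc : 2 ≤ c)
include hc

lemma integrableOn_log_pow {k : ℕ} (hk : k ≠ 0) :
    IntegrableOn (fun θ : Fin 2 → ℝ => Real.log ‖torusEval (polyXYC c) θ‖ ^ k) (Set.Icc 0 1) := by
  have h1 := (integrableOn_torusEval_iff (stronglyMeasurable_ofReal_cpow 1).norm c).1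
    (integrableOn_torusEval_cpow hc (s := 1) (Or.inr (by norm_num))).norm
  have h2 := (integrableOn_torusEval_iff (stronglyMeasurable_ofReal_cpow (-1)).norm c).1
    (integrableOn_torusEval_cpow hc (s := -1) (Or.inr (by norm_num))).norm
  have hF : StronglyMeasurable fun t : ℝ => Real.log t ^ k :=
    (Real.measurable_log.pow_const k).stronglyMeasurable
  rw [integrableOn_torusEval_iff hF]
  refine ((h1.add h2).const_mul (k.factorial : ℝ)).mono'
    (hF.comp_measurable (continuous_fiberNorm c).measurable).aestronglyMeasurable
    (.of_forall fun p => ?_)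
  simp only [Pi.add_apply, Complex.cpow_one, Complex.cpow_neg_one, norm_inv, Complex.norm_real]
  have hp : 0 ≤ fiberNorm c p := norm_nonneg _
  rw [Real.norm_of_nonneg hp, norm_pow, Real.norm_eq_abs]
  rcases hp.eq_or_lt with h0 | h0
  · simp [← h0, hk]
  · have h3 := Real.pow_div_factorial_le_exp _ (abs_nonneg (Real.log (fiberNorm c p))) k
    rw [div_le_iff₀ (by positivity), mul_comm] at h3
    refine h3.trans (mul_le_mul_of_nonneg_left ?_ (by positivity))
    have h4 : 0 < (fiberNorm c p)⁻¹ := by positivity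
    rcases abs_cases (Real.log (fiberNorm c p)) with ⟨h, -⟩ | ⟨h, -⟩
    · rw [h, Real.exp_log h0]; linarith
    · rw [h, Real.exp_neg, Real.exp_log h0]; linarith

lemma integral_log_sub_pow {k : ℕ} {A : ℕ → ℝ} (hA : Summable fun n => ‖A n‖)
    (hi : IntegrableOn (fun θ : Fin 2 → ℝ =>
      (Real.log ‖torusEval (polyXYC c) θ‖ - Real.log c) ^ k) (Set.Icc 0 1))
    (h : ∀ w : ℂ, ‖w‖ < 1 → ∫ a, Real.log ‖1 + w * unitChar a‖ ^ k = ∑' n, A n * ‖w‖ ^ (2 * n)) :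
    ∫ θ in Set.Icc (0 : Fin 2 → ℝ) 1, (Real.log ‖torusEval (polyXYC c) θ‖ - Real.log c) ^ k
      = ∑' n, (Nat.choose (2 * n) n : ℝ) * (A n / c ^ (2 * n)) := by
  have hc0 : 0 < c := by linarith
  refine integral_torus_eq_tsum (F := fun t => (Real.log t - Real.log c) ^ k)
    (A := fun n => A n / c ^ (2 * n))
    ((Real.measurable_log.sub_const _).pow_const k).stronglyMeasurable hc ?_ hi fun w hw => ?_
  · refine hA.of_nonneg_of_le (fun _ => by positivity) fun n => ?_
    rw [norm_div, Real.norm_of_nonneg (by positivity : 0 ≤ c ^ (2 * n)), mul_div_assoc',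
      mul_div_right_comm]
    exact mul_le_of_le_one_left (norm_nonneg _) (choose_two_mul_div_le hc n)
  · have e : ∀ a, Real.log (c * ‖1 + w * unitChar a‖) - Real.log c
        = Real.log ‖1 + w * unitChar a‖ := fun a => by
      rw [Real.log_mul hc0.ne' (norm_ne_zero_iff.2 (one_add_ne_zero_of_norm_lt_one
        (norm_mul_unitChar_lt hw a)))]
      ring
    simp_rw [e, h w hw, smul_eq_mul, mul_pow]
    congr 1; ext n
    field_simp

lemma summable_choose_div_sq : Summable fun k : ℕ =>
    (Nat.choose (2 * k) k : ℝ) * (1 / ((k : ℝ) ^ 2 * c ^ (2 * k))) := by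
  have hc0 : 0 < c := by linarith
  refine (Real.summable_one_div_nat_pow (p := 2).2 one_lt_two).of_nonneg_of_le
    (fun _ => by positivity) fun k => ?_
  have h := mul_le_mul_of_nonneg_left (choose_two_mul_div_le hc k)
    (by positivity : 0 ≤ 1 / (k : ℝ) ^ 2)
  calc _ = 1 / (k : ℝ) ^ 2 * ((Nat.choose (2 * k) k : ℝ) / c ^ (2 * k)) := by
        rw [one_div, mul_inv]; ring
    _ ≤ _ := h.trans_eq (mul_one _)

lemma summable_choose_harmonicSum : Summable fun k : ℕ =>
    (Nat.choose (2 * (k + 1)) (k + 1) : ℝ) * (1 / (((k + 1 : ℕ) : ℝ) ^ 2 * c ^ (2 * (k + 1)))) *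
      harmonicSum k := by
  have hc0 : 0 < c := by linarith
  refine summable_harmonicSum_div_sq.of_nonneg_of_le
    (fun k => mul_nonneg (by positivity) (harmonicSum_nonneg k)) fun k => ?_
  have h := mul_le_mul_of_nonneg_left (choose_two_mul_div_le hc (k + 1))
    (div_nonneg (harmonicSum_nonneg k) (by positivity : 0 ≤ ((k : ℝ) + 1) ^ 2))
  calc _ = harmonicSum k / ((k : ℝ) + 1) ^ 2 *
          ((Nat.choose (2 * (k + 1)) (k + 1) : ℝ) / c ^ (2 * (k + 1))) := by
        rw [one_div, mul_inv]; push_cast; ring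
    _ ≤ _ := h.trans_eq (mul_one _)

lemma tsum_choose_div_sq_succ : ∑' k : ℕ, (Nat.choose (2 * k) k : ℝ) *
      (1 / 2 * (1 / (k : ℝ) ^ 2) / c ^ (2 * k))
    = 1 / 2 * ∑' k : ℕ, (Nat.choose (2 * (k + 1)) (k + 1) : ℝ) *
            (1 / (((k + 1 : ℕ) : ℝ) ^ 2 * c ^ (2 * (k + 1)))) := by
  have h := (summable_choose_div_sq hc).tsum_eq_zero_add
  simp only [CharP.cast_eq_zero, ne_eq, OfNat.ofNat_ne_zero, not_false_eq_true, zero_pow, zero_mul,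
    div_zero, mul_zero, zero_add] at h
  rw [← h, ← tsum_mul_left]
  congr 1; ext k
  simp only [one_div, mul_inv]; ring

lemma tsum_choose_reciprocalConv : ∑' k : ℕ, (Nat.choose (2 * k) k : ℝ) *
      (-(3 / 4) * (reciprocalConv k / k) / c ^ (2 * k))
    = -(3 / 2) * ∑' k : ℕ, (Nat.choose (2 * (k + 1)) (k + 1) : ℝ) *
        (1 / (((k + 1 : ℕ) : ℝ) ^ 2 * c ^ (2 * (k + 1)))) * harmonicSum k := by
  have e : ∀ k : ℕ, (Nat.choose (2 * (k + 1)) (k + 1) : ℝ) *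
      (-(3 / 4) * (reciprocalConv (k + 1) / (k + 1 : ℕ)) / c ^ (2 * (k + 1))) =
      -(3 / 2) * ((Nat.choose (2 * (k + 1)) (k + 1) : ℝ) *
        (1 / (((k + 1 : ℕ) : ℝ) ^ 2 * c ^ (2 * (k + 1)))) * harmonicSum k) := by
    intro k
    rw [reciprocalConv_succ]
    push_cast
    field_simp
    ring
  rw [Summable.tsum_eq_zero_add ((summable_nat_add_iff 1).1 (by
    simpa only [e] using (summable_choose_harmonicSum hc).mul_left (-(3 / 2))))]
  simp only [e, tsum_mul_left]
  simp

lemma tsum_choose_harmonicSum_succ : ∑' k : ℕ, (Nat.choose (2 * (k + 1)) (k + 1) : ℝ) *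
        (1 / (((k + 1 : ℕ) : ℝ) ^ 2 * c ^ (2 * (k + 1)))) * harmonicSum k
    = ∑' k : ℕ, (Nat.choose (2 * (k + 2)) (k + 2) : ℝ) *
        (1 / (((k + 2 : ℕ) : ℝ) ^ 2 * c ^ (2 * (k + 2)))) *
          ∑ j ∈ Finset.Icc 1 (k + 1), 1 / (j : ℝ) := by
  rw [(summable_choose_harmonicSum hc).tsum_eq_zero_add]
  simp_rw [harmonicSum_eq_sum_Icc]
  simp [harmonicSum, add_assoc]

lemma integral_log_sub : ∫ θ in Set.Icc (0 : Fin 2 → ℝ) 1,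
    (Real.log ‖torusEval (polyXYC c) θ‖ - Real.log c) = 0 := by
  have h1 := integrableOn_log_pow hc one_ne_zero
  simp only [pow_one] at h1
  have h := integral_log_sub_pow hc (k := 1) (A := 0) (by simp)
    (by
      simp only [pow_one]
      exact h1.sub (integrableOn_const isCompact_Icc.measure_lt_top.ne)) fun w hw => by
      simpa using integral_log_norm_one_add hw
  simpa using h

lemma integral_log_sub_sq : ∫ θ in Set.Icc (0 : Fin 2 → ℝ) 1,
    (Real.log ‖torusEval (polyXYC c) θ‖ - Real.log c) ^ 2
    = 1 / 2 * ∑' k : ℕ, (Nat.choose (2 * (k + 1)) (k + 1) : ℝ) *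
            (1 / (((k + 1 : ℕ) : ℝ) ^ 2 * c ^ (2 * (k + 1)))) := by
  have h1 := integrableOn_log_pow hc one_ne_zero
  have h2 := integrableOn_log_pow hc two_ne_zero
  rw [← tsum_choose_div_sq_succ hc]
  refine integral_log_sub_pow hc ?_ ?_ fun w hw => integral_log_norm_one_add_sq hw
  · exact ((Real.summable_one_div_nat_pow (p := 2).2 one_lt_two).mul_left (1 / 2)).norm
  · refine ((h2.sub (h1.const_mul (2 * Real.log c))).add
      (integrableOn_const (C := Real.log c ^ 2) isCompact_Icc.measure_lt_top.ne)).congr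
      (.of_forall fun θ => ?_)
    simp only [Pi.add_apply, Pi.sub_apply]
    ring

lemma integral_log_sub_cube : ∫ θ in Set.Icc (0 : Fin 2 → ℝ) 1,
    (Real.log ‖torusEval (polyXYC c) θ‖ - Real.log c) ^ 3
    = -(3 / 2) * ∑' k : ℕ, (Nat.choose (2 * (k + 1)) (k + 1) : ℝ) *
        (1 / (((k + 1 : ℕ) : ℝ) ^ 2 * c ^ (2 * (k + 1)))) * harmonicSum k := by
  have h1 := integrableOn_log_pow hc one_ne_zero
  have h2 := integrableOn_log_pow hc two_ne_zero
  have h3 := integrableOn_log_pow hc three_ne_zero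
  rw [← tsum_choose_reciprocalConv hc]
  refine integral_log_sub_pow hc ?_ ?_ fun w hw => integral_log_norm_one_add_cube hw
  · exact (summable_reciprocalConv_div.mul_left (-(3 / 4))).norm
  · refine (((h3.sub (h2.const_mul (3 * Real.log c))).add (h1.const_mul (3 * Real.log c ^ 2))).sub
      (integrableOn_const (C := Real.log c ^ 3) isCompact_Icc.measure_lt_top.ne)).congr
      (.of_forall fun θ => ?_)
    simp only [Pi.add_apply, Pi.sub_apply]
    ring

lemma integral_log_polyXYC : ∫ θ in Set.Icc (0 : Fin 2 → ℝ) 1,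
    Real.log ‖torusEval (polyXYC c) θ‖ = Real.log c := by
  have h1 := integrableOn_log_pow hc one_ne_zero
  simp only [pow_one] at h1
  have h := integral_log_sub hc
  rw [integral_sub h1 (integrableOn_const isCompact_Icc.measure_lt_top.ne), setIntegral_const,
    volume_Icc_fin_two] at h
  simpa [sub_eq_zero] using h

lemma higherMahler_two_polyXYC : higherMahler 2 (polyXYC c) = Real.log c ^ 2 +
    1 / 2 * ∑' k : ℕ, (Nat.choose (2 * (k + 1)) (k + 1) : ℝ) *
            (1 / (((k + 1 : ℕ) : ℝ) ^ 2 * c ^ (2 * (k + 1)))) := by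
  have h1 := integrableOn_log_pow hc one_ne_zero
  have h2 := integrableOn_log_pow hc two_ne_zero
  simp only [pow_one] at h1
  rw [← integral_log_sub_sq hc]
  have e : ∀ θ : Fin 2 → ℝ, (Real.log ‖torusEval (polyXYC c) θ‖ - Real.log c) ^ 2
      = Real.log ‖torusEval (polyXYC c) θ‖ ^ 2
        - 2 * Real.log c * Real.log ‖torusEval (polyXYC c) θ‖ + Real.log c ^ 2 := fun θ => by ring
  have h21 : IntegrableOn (fun θ => Real.log ‖torusEval (polyXYC c) θ‖ ^ 2
      - 2 * Real.log c * Real.log ‖torusEval (polyXYC c) θ‖) (Set.Icc 0 1) :=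
    h2.sub (h1.const_mul _)
  simp_rw [e]
  rw [integral_add h21 (integrableOn_const isCompact_Icc.measure_lt_top.ne),
    integral_sub h2 (h1.const_mul _), integral_const_mul, integral_log_polyXYC hc,
    setIntegral_const, volume_Icc_fin_two, higherMahler, smul_eq_mul]
  ring

lemma higherMahler_three_polyXYC : higherMahler 3 (polyXYC c) = Real.log c ^ 3
    + 3 / 2 * Real.log c * ∑' k : ℕ, (Nat.choose (2 * (k + 1)) (k + 1) : ℝ) *
            (1 / (((k + 1 : ℕ) : ℝ) ^ 2 * c ^ (2 * (k + 1))))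
    - 3 / 2 * ∑' k : ℕ, (Nat.choose (2 * (k + 1)) (k + 1) : ℝ) *
        (1 / (((k + 1 : ℕ) : ℝ) ^ 2 * c ^ (2 * (k + 1)))) * harmonicSum k := by
  have h1 := integrableOn_log_pow hc one_ne_zero
  have h2 := integrableOn_log_pow hc two_ne_zero
  have h3 := integrableOn_log_pow hc three_ne_zero
  have hm2 := higherMahler_two_polyXYC hc
  have hm3 := integral_log_sub_cube hc
  simp only [pow_one] at h1
  have e : ∀ θ : Fin 2 → ℝ, (Real.log ‖torusEval (polyXYC c) θ‖ - Real.log c) ^ 3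
      = Real.log ‖torusEval (polyXYC c) θ‖ ^ 3
        - 3 * Real.log c * Real.log ‖torusEval (polyXYC c) θ‖ ^ 2
        + 3 * Real.log c ^ 2 * Real.log ‖torusEval (polyXYC c) θ‖ - Real.log c ^ 3 :=
    fun θ => by ring
  have h32 : IntegrableOn (fun θ => Real.log ‖torusEval (polyXYC c) θ‖ ^ 3
      - 3 * Real.log c * Real.log ‖torusEval (polyXYC c) θ‖ ^ 2) (Set.Icc 0 1) :=
    h3.sub (h2.const_mul _)
  have h321 : IntegrableOn (fun θ => Real.log ‖torusEval (polyXYC c) θ‖ ^ 3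
      - 3 * Real.log c * Real.log ‖torusEval (polyXYC c) θ‖ ^ 2
      + 3 * Real.log c ^ 2 * Real.log ‖torusEval (polyXYC c) θ‖) (Set.Icc 0 1) :=
    h32.add (h1.const_mul _)
  simp_rw [e] at hm3
  rw [integral_sub h321 (integrableOn_const isCompact_Icc.measure_lt_top.ne),
    integral_add h32 (h1.const_mul _),
    integral_sub h3 (h2.const_mul _), integral_const_mul, integral_const_mul,
    integral_log_polyXYC hc, setIntegral_const, volume_Icc_fin_two, smul_eq_mul,
    ← higherMahler, ← higherMahler, hm2] at hm3
  linear_combination hm3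

end Log

lemma hasSum_sub_succ_of_antitone {f : ℕ → ℝ} (hf : Antitone f)
    (h0 : Filter.Tendsto f Filter.atTop (nhds 0)) : HasSum (fun n => f n - f (n + 1)) (f 0) := by
  rw [hasSum_iff_tendsto_nat_of_nonneg fun n => sub_nonneg.2 (hf n.le_succ)]
  simp_rw [Finset.sum_range_sub']
  simpa using h0.const_sub (f 0)

lemma hasSum_one_div_sub_one_div_add (p : ℕ) :
    HasSum (fun m : ℕ => 1 / ((m : ℝ) + 1) - 1 / ((m : ℝ) + 1 + p)) (harmonicSum p) := by
  induction p with
  | zero => simp [harmonicSum]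
  | succ p ih =>
    have h : HasSum (fun m : ℕ => 1 / (((m : ℝ) + p) + 1) - 1 / ((((m + 1 : ℕ) : ℝ) + p) + 1))
        (1 / ((((0 : ℕ) : ℝ) + p) + 1)) := by
      refine hasSum_sub_succ_of_antitone (f := fun m : ℕ => 1 / (((m : ℝ) + p) + 1)) ?_ ?_
      · intro a b hab
        have : (a : ℝ) ≤ b := by exact_mod_cast hab
        exact one_div_le_one_div_of_le (by positivity) (by linarith)
      · have h := (tendsto_one_div_add_atTop_nhds_zero_nat (𝕜 := ℝ)).comp
          (Filter.tendsto_add_atTop_nat p)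
        refine h.congr fun m => ?_
        simp
    rw [harmonicSum, Finset.sum_range_succ, ← harmonicSum]
    have e : (fun m : ℕ => 1 / ((m : ℝ) + 1) - 1 / ((m : ℝ) + 1 + ((p + 1 : ℕ) : ℝ)))
        = fun m : ℕ => (1 / ((m : ℝ) + 1) - 1 / ((m : ℝ) + 1 + p)) +
          (1 / (((m : ℝ) + p) + 1) - 1 / ((((m + 1 : ℕ) : ℝ) + p) + 1)) := by
      ext m
      push_cast
      ring_nf
    rw [e]
    simpa using ih.add h

/-- Euler's evaluation of the double zeta value `ζ(2, 1)`. -/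
lemma tsum_harmonicSum_div_sq :
    ∑' n : ℕ, harmonicSum n / ((n : ℝ) + 1) ^ 2 = ∑' n : ℕ, 1 / ((n : ℝ) + 1) ^ 3 := by
  set f : ℕ × ℕ → ℝ := fun p => 1 / (((p.1 : ℝ) + 1) * ((p.2 : ℝ) + 1) * ((p.1 : ℝ) + p.2 + 2))
    with hf
  have hf0 : 0 ≤ f := fun p => by simp only [hf, Pi.zero_apply]; positivity
  have row : ∀ n : ℕ, HasSum (fun m => f (n, m)) (harmonicSum (n + 1) / ((n : ℝ) + 1) ^ 2) := by
    intro n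
    have h := (hasSum_one_div_sub_one_div_add (n + 1)).div_const (((n : ℝ) + 1) ^ 2)
    refine Eq.mp (congrArg (HasSum · _) (funext fun m => ?_)) h
    simp only [hf]
    have h1 : (m : ℝ) + 1 + (n + 1) ≠ 0 := by positivity
    have h2 : (n : ℝ) + m + 2 ≠ 0 := by positivity
    push_cast
    field_simp
    ring
  have hE := summable_harmonicSum_div_sq
  have h3 : Summable fun n : ℕ => 1 / ((n : ℝ) + 1) ^ 3 := by
    have := (summable_nat_add_iff 1).2 ((Real.summable_one_div_nat_pow (p := 3)).2 (by norm_num))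
    simpa using this
  have erow : ∀ n : ℕ, harmonicSum (n + 1) / ((n : ℝ) + 1) ^ 2
      = harmonicSum n / ((n : ℝ) + 1) ^ 2 + 1 / ((n : ℝ) + 1) ^ 3 := by
    intro n
    rw [harmonicSum, Finset.sum_range_succ, ← harmonicSum]
    field_simp
  have hsum : Summable f := by
    rw [summable_prod_of_nonneg hf0]
    refine ⟨fun n => (row n).summable, ?_⟩
    simp_rw [fun n => (row n).tsum_eq, erow]
    exact hE.add h3
  have e1 : ∑' p, f p = ∑' n : ℕ, harmonicSum n / ((n : ℝ) + 1) ^ 2 + ∑' n : ℕ, 1 / ((n : ℝ) + 1) ^ 3 := by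
    rw [hsum.tsum_prod]
    simp_rw [fun n => (row n).tsum_eq, erow]
    exact hE.tsum_add h3
  have diag : ∀ n, ∑ p ∈ Finset.HasAntidiagonal.antidiagonal n, f p
      = 2 * (harmonicSum (n + 1) / (((n + 1 : ℕ) : ℝ) + 1) ^ 2) := by
    intro n
    have h1 : reciprocalConv (n + 2) / (n + 2)
        = ∑ p ∈ Finset.HasAntidiagonal.antidiagonal n, f p := by
      rw [reciprocalConv, Finset.Nat.antidiagonal_succ_succ']
      simp only [Finset.sum_cons, Finset.sum_map, Finset.sum_div, add_div]
      simp only [CharP.cast_eq_zero, div_zero, zero_mul, mul_zero, zero_div, zero_add]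
      refine Finset.sum_congr rfl fun p hp => ?_
      rw [← Finset.HasAntidiagonal.mem_antidiagonal.mp hp]
      simp [hf]
      field_simp
    rw [← h1, reciprocalConv_succ]
    push_cast
    field_simp
    ring
  have e2 : ∑' p, f p = 2 * ∑' n : ℕ, harmonicSum n / ((n : ℝ) + 1) ^ 2 := by
    have h := (Finset.HasAntidiagonal.sigmaAntidiagonalEquivProd.summable_iff.2 hsum).tsum_sigma'
      fun n => (hasSum_fintype _).summable
    have h2 := Finset.HasAntidiagonal.sigmaAntidiagonalEquivProd.tsum_eq f
    rw [← h2]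
    refine h.trans ?_
    rw [hE.tsum_eq_zero_add, show harmonicSum 0 = 0 by simp [harmonicSum], zero_div, zero_add,
      ← tsum_mul_left]
    congr 1; ext n
    rw [← diag, tsum_fintype, Finset.univ_eq_attach, ← Finset.sum_attach (Finset.HasAntidiagonal.antidiagonal n) f]
    rfl
  linarith

/-- The power series with coefficients `u 0, u 1, …` at the exponents `1, 2, …`. -/
noncomputable def shiftSeries (u : ℕ → ℝ) (t : ℝ) : ℝ := ∑' k, u k * t ^ (k + 1)

lemma shiftSeries_zero (u : ℕ → ℝ) : shiftSeries u 0 = 0 := by simp [shiftSeries]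

lemma shiftSeries_one (u : ℕ → ℝ) : shiftSeries u 1 = ∑' k, u k := by simp [shiftSeries]

lemma continuousOn_shiftSeries {u : ℕ → ℝ} (hu : Summable fun k => |u k|) :
    ContinuousOn (shiftSeries u) (Set.Icc 0 1) := by
  refine continuousOn_tsum (fun k => by fun_prop) hu fun k x hx => ?_
  rw [norm_mul, norm_pow, Real.norm_eq_abs, Real.norm_of_nonneg hx.1]
  exact mul_le_of_le_one_right (abs_nonneg _) (pow_le_one₀ hx.1 hx.2)

lemma hasDerivAt_shiftSeries {u : ℕ → ℝ} {M : ℝ} (hu : ∀ k, |u k| ≤ M) {t : ℝ}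
    (ht0 : 0 < t) (ht1 : t < 1) :
    HasDerivAt (shiftSeries fun k => u k / (k + 1)) (shiftSeries u t / t) t := by
  obtain ⟨r, htr, hr1⟩ := exists_between ht1
  have hr0 : 0 < r := ht0.trans htr
  have hM : 0 ≤ M := (abs_nonneg _).trans (hu 0)
  have h := hasDerivAt_tsum_of_isPreconnected (u := fun k => M * r ^ k)
    (g := fun (k : ℕ) (x : ℝ) => u k / (k + 1) * x ^ (k + 1)) (g' := fun k x => u k * x ^ k)
    (t := Set.Ioo (-r) r) (y₀ := 0) (y := t)
    ((summable_geometric_of_lt_one hr0.le hr1).mul_left M) isOpen_Ioo isPreconnected_Ioo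
    (fun k y _ => by
      have h1 := (hasDerivAt_pow (k + 1) y).const_mul (u k / (k + 1))
      have h2 : ((k : ℝ) + 1) ≠ 0 := by positivity
      refine h1.congr_deriv ?_
      push_cast
      field_simp)
    (fun k y hy => by
      rw [norm_mul, norm_pow, Real.norm_eq_abs, Real.norm_eq_abs]
      exact mul_le_mul (hu k) (pow_le_pow_left₀ (abs_nonneg _) (abs_lt.2 hy).le _)
        (by positivity) hM)
    ⟨by linarith, hr0⟩ (by simp) ⟨by linarith, htr⟩
  refine h.congr_deriv ?_
  rw [shiftSeries, ← tsum_div_const]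
  congr 1; ext k
  rw [pow_succ]
  field_simp

lemma shiftSeries_one_div_succ {t : ℝ} (ht0 : 0 ≤ t) (ht1 : t < 1) :
    shiftSeries (fun k => 1 / ((k : ℝ) + 1)) t = -Real.log (1 - t) := by
  rw [← (Real.hasSum_pow_div_log_of_abs_lt_one (abs_lt.2 ⟨by linarith, ht1⟩)).tsum_eq, shiftSeries]
  congr 1; ext k
  ring

lemma hasSum_reciprocalConv_mul_pow {t : ℝ} (ht0 : 0 ≤ t) (ht1 : t < 1) :
    HasSum (fun n => reciprocalConv n * t ^ n) (Real.log (1 - t) ^ 2) := by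
  have h0 := (Real.hasSum_pow_div_log_of_abs_lt_one (abs_lt.2 ⟨by linarith, ht1⟩))
  have h : HasSum (fun n : ℕ => t ^ n / n) (-Real.log (1 - t)) := by
    rw [← hasSum_nat_add_iff' 1]
    simpa using h0
  have hn : Summable fun n : ℕ => ‖t ^ n / n‖ := h.summable.norm
  have e : ∀ n : ℕ, ∑ p ∈ Finset.HasAntidiagonal.antidiagonal n, t ^ p.1 / p.1 * (t ^ p.2 / p.2)
      = reciprocalConv n * t ^ n := by
    intro n
    rw [reciprocalConv, Finset.sum_mul]
    refine Finset.sum_congr rfl fun p hp => ?_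
    rw [← Finset.HasAntidiagonal.mem_antidiagonal.mp hp, pow_add]
    ring
  have h1 := tsum_mul_tsum_eq_tsum_sum_antidiagonal_of_summable_norm hn hn
  have h2 := (summable_norm_sum_mul_antidiagonal_of_summable_norm hn hn).of_norm
  simp_rw [e] at h1 h2
  rw [h.tsum_eq] at h1
  rw [← neg_sq, sq, h1]
  exact h2.hasSum

lemma shiftSeries_harmonicSum_div {t : ℝ} (ht0 : 0 ≤ t) (ht1 : t < 1) :
    shiftSeries (fun k => harmonicSum k / ((k : ℝ) + 1)) t = Real.log (1 - t) ^ 2 / 2 := by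
  have h := hasSum_reciprocalConv_mul_pow ht0 ht1
  rw [← h.tsum_eq, h.summable.tsum_eq_zero_add, reciprocalConv_zero, zero_mul, zero_add,
    ← tsum_div_const, shiftSeries]
  congr 1; ext k
  rw [reciprocalConv_succ]
  ring

lemma harmonicSum_le (n : ℕ) : harmonicSum n ≤ n := by
  calc harmonicSum n ≤ ∑ _j ∈ Finset.range n, (1 : ℝ) := by
        refine Finset.sum_le_sum fun j _ => ?_
        rw [div_le_one (by positivity)]
        linarith [(Nat.cast_nonneg j : (0 : ℝ) ≤ j)]
    _ = n := by simp

lemma eq_of_hasDerivAt_eq {f g f' : ℝ → ℝ} (hf : ContinuousOn f (Set.Icc 0 1))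
    (hg : ContinuousOn g (Set.Icc 0 1)) (h0 : f 0 = g 0)
    (hf' : ∀ x ∈ Set.Ioo (0 : ℝ) 1, HasDerivAt f (f' x) x)
    (hg' : ∀ x ∈ Set.Ioo (0 : ℝ) 1, HasDerivAt g (f' x) x) : f 1 = g 1 := by
  obtain ⟨c, -, hc⟩ := exists_hasDerivAt_eq_slope (fun x => f x - g x) (fun x => f' x - f' x)
    zero_lt_one (hf.sub hg) fun x hx => (hf' x hx).sub (hg' x hx)
  simp only [sub_self, h0, sub_zero, div_one] at hc
  linarith

/-- The mean of `cos (πθ) ^ (2 k)`, namely `4 ^ (-k)` times the central binomial coefficient. -/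
noncomputable def cosMoment (k : ℕ) : ℝ := (Nat.choose (2 * k) k : ℝ) / 2 ^ (2 * k)

lemma cosMoment_nonneg (k : ℕ) : 0 ≤ cosMoment k := by unfold cosMoment; positivity

lemma cosMoment_le_one (k : ℕ) : cosMoment k ≤ 1 := choose_two_mul_div_le le_rfl k

lemma hasSum_integral_cosMoment {a : ℕ → ℝ} {t : ℝ} (ha : Summable fun k => |a k * t ^ k|) :
    HasSum (fun k => cosMoment k * (a k * t ^ k))
      (∫ b, ∑' k, a k * (t * (‖1 + unitChar b‖ / 2) ^ 2) ^ k) := by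
  have h := hasSum_integral_outer (A := fun k => a k * t ^ k / 2 ^ (2 * k)) (by
    refine ha.of_nonneg_of_le (fun _ => by positivity) fun k => ?_
    rw [norm_div, Real.norm_of_nonneg (by positivity : (0 : ℝ) ≤ 2 ^ (2 * k)), mul_div_assoc',
      mul_div_right_comm]
    exact mul_le_of_le_one_left (norm_nonneg _) (cosMoment_le_one k))
  refine Eq.mp (congrArg₂ HasSum (funext fun k => ?_) ?_) h
  · rw [cosMoment, smul_eq_mul]; ring
  · congr 1; ext b
    congr 1; ext k
    rw [smul_eq_mul, mul_pow, ← pow_mul, div_pow]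
    ring

section Landen
variable {q : ℝ}

lemma one_sub_landen_mul (hq : 0 ≤ q) (b : UnitAddCircle) :
    1 - 4 * q / (1 + q) ^ 2 * (‖1 + unitChar b‖ / 2) ^ 2
      = (‖1 + (-q : ℂ) * unitChar b‖ / (1 + q)) ^ 2 := by
  have h0 : (1 + q) ≠ 0 := by positivity
  have h1 := norm_unitChar b
  have h2 : (unitChar b).re ^ 2 + (unitChar b).im ^ 2 = 1 := by
    rw [← one_pow 2, ← h1, Complex.sq_norm, Complex.normSq_apply]; ring
  rw [div_pow, div_pow, Complex.sq_norm, Complex.sq_norm, Complex.normSq_apply,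
    Complex.normSq_apply]
  simp
  field_simp
  linear_combination (-4 * (q ^ 2 + q)) * h2

lemma landen_nonneg (hq : 0 ≤ q) : 0 ≤ 4 * q / (1 + q) ^ 2 := by positivity

lemma landen_lt_one (hq : 0 ≤ q) (hq1 : q < 1) : 4 * q / (1 + q) ^ 2 < 1 := by
  rw [div_lt_one (by positivity)]
  nlinarith [sq_pos_of_pos (sub_pos.2 hq1)]

lemma landen_mul_nonneg (hq : 0 ≤ q) (b : UnitAddCircle) :
    0 ≤ 4 * q / (1 + q) ^ 2 * (‖1 + unitChar b‖ / 2) ^ 2 :=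
  mul_nonneg (landen_nonneg hq) (by positivity)

lemma landen_mul_lt_one (hq : 0 ≤ q) (hq1 : q < 1) (b : UnitAddCircle) :
    4 * q / (1 + q) ^ 2 * (‖1 + unitChar b‖ / 2) ^ 2 < 1 := by
  refine (mul_le_of_le_one_right (landen_nonneg hq) (pow_le_one₀ (by positivity) ?_)).trans_lt
    (landen_lt_one hq hq1)
  linarith [norm_one_add_unitChar_le b]

lemma norm_neg_ofReal_lt_one (hq : 0 ≤ q) (hq1 : q < 1) : ‖(-q : ℂ)‖ < 1 := by
  rwa [norm_neg, Complex.norm_real, Real.norm_of_nonneg hq]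

lemma log_one_sub_landen_mul (hq : 0 ≤ q) (hq1 : q < 1) (b : UnitAddCircle) :
    Real.log (1 - 4 * q / (1 + q) ^ 2 * (‖1 + unitChar b‖ / 2) ^ 2)
      = 2 * Real.log ‖1 + (-q : ℂ) * unitChar b‖ - 2 * Real.log (1 + q) := by
  rw [one_sub_landen_mul hq, Real.log_pow, Real.log_div (norm_ne_zero_iff.2
    (one_add_ne_zero_of_norm_lt_one (norm_mul_unitChar_lt (norm_neg_ofReal_lt_one hq hq1) b)))
    (by positivity)]
  push_cast
  ring

lemma integrable_log_norm_one_add_pow (hq : 0 ≤ q) (hq1 : q < 1) (k : ℕ) :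
    Integrable fun b => Real.log ‖1 + (-q : ℂ) * unitChar b‖ ^ k := by
  refine integrable_of_continuous_unitAddCircle (Continuous.pow ?_ k)
  simp_rw [← Complex.log_re]
  exact Complex.continuous_re.comp
    (continuous_log_one_add_unitChar (norm_neg_ofReal_lt_one hq hq1))

/-- The generating function of `cosMoment k / k`, in Landen's parametrization. -/
lemma shiftSeries_cosMoment_div (hq : 0 ≤ q) (hq1 : q < 1) :
    shiftSeries (fun k => cosMoment (k + 1) / ((k : ℝ) + 1)) (4 * q / (1 + q) ^ 2)
      = 2 * Real.log (1 + q) := by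
  set t := 4 * q / (1 + q) ^ 2 with ht
  have ser : ∀ x : ℝ, 0 ≤ x → x < 1 → HasSum (fun k : ℕ => 1 / (k : ℝ) * x ^ k)
      (-Real.log (1 - x)) := by
    intro x hx hx1
    have h0 := (Real.hasSum_pow_div_log_of_abs_lt_one (abs_lt.2 ⟨by linarith, hx1⟩))
    rw [← hasSum_nat_add_iff' 1]
    simpa [div_eq_inv_mul] using h0
  have h := hasSum_integral_cosMoment (ser _ (landen_nonneg hq) (landen_lt_one hq hq1)).summable.norm
  simp_rw [fun b => (ser _ (landen_mul_nonneg hq b) (landen_mul_lt_one hq hq1 b)).tsum_eq,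
    log_one_sub_landen_mul hq hq1] at h
  have i1 := integrable_log_norm_one_add_pow hq hq1 1
  simp only [pow_one] at i1
  rw [integral_neg, integral_sub (i1.const_mul 2) (integrable_const _), integral_const_mul,
    integral_log_norm_one_add (norm_neg_ofReal_lt_one hq hq1)] at h
  have h2 := h.summable.tsum_eq_zero_add
  rw [h.tsum_eq] at h2
  simp only [integral_const, probReal_univ, smul_eq_mul] at h2
  rw [shiftSeries]
  simp only [CharP.cast_eq_zero, div_zero, zero_mul, mul_zero, zero_add, zero_sub, neg_neg,
    one_mul] at h2
  rw [h2]
  congr 1; ext k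
  push_cast
  ring

/-- The generating function of `cosMoment k * H (k - 1) / k`, in Landen's parametrization. -/
lemma shiftSeries_cosMoment_mul_harmonicSum (hq : 0 ≤ q) (hq1 : q < 1) :
    shiftSeries (fun k => cosMoment (k + 1) * harmonicSum k / ((k : ℝ) + 1)) (4 * q / (1 + q) ^ 2)
      = shiftSeries (fun k => 1 / ((k : ℝ) + 1) ^ 2) (q ^ 2) + 2 * Real.log (1 + q) ^ 2 := by
  set t := 4 * q / (1 + q) ^ 2 with ht
  have h := hasSum_integral_cosMoment
    (hasSum_reciprocalConv_mul_pow (landen_nonneg hq) (landen_lt_one hq hq1)).summable.norm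
  simp_rw [fun b => (hasSum_reciprocalConv_mul_pow (landen_mul_nonneg hq b)
    (landen_mul_lt_one hq hq1 b)).tsum_eq, log_one_sub_landen_mul hq hq1] at h
  have i1 := integrable_log_norm_one_add_pow hq hq1 1
  have i2 := integrable_log_norm_one_add_pow hq hq1 2
  simp only [pow_one] at i1
  have e : ∀ b, (2 * Real.log ‖1 + (-q : ℂ) * unitChar b‖ - 2 * Real.log (1 + q)) ^ 2
      = 4 * Real.log ‖1 + (-q : ℂ) * unitChar b‖ ^ 2
        - 8 * Real.log (1 + q) * Real.log ‖1 + (-q : ℂ) * unitChar b‖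
        + 4 * Real.log (1 + q) ^ 2 := fun b => by ring
  have i21 : Integrable fun b => 4 * Real.log ‖1 + (-q : ℂ) * unitChar b‖ ^ 2
        - 8 * Real.log (1 + q) * Real.log ‖1 + (-q : ℂ) * unitChar b‖ :=
    (i2.const_mul 4).sub (i1.const_mul _)
  simp_rw [e] at h
  rw [integral_add i21 (integrable_const _), integral_sub (i2.const_mul 4) (i1.const_mul _),
    integral_const_mul, integral_const_mul,
    integral_log_norm_one_add (norm_neg_ofReal_lt_one hq hq1),
    integral_log_norm_one_add_sq (norm_neg_ofReal_lt_one hq hq1)] at h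
  have h2 := h.summable.tsum_eq_zero_add
  rw [h.tsum_eq] at h2
  simp only [integral_const, probReal_univ, smul_eq_mul, reciprocalConv_zero, zero_mul,
    mul_zero, zero_add, sub_zero, one_mul] at h2
  have e1 : ∑' k, cosMoment (k + 1) * (reciprocalConv (k + 1) * t ^ (k + 1))
      = 2 * shiftSeries (fun k => cosMoment (k + 1) * harmonicSum k / ((k : ℝ) + 1)) t := by
    rw [shiftSeries, ← tsum_mul_left]
    congr 1; ext k
    rw [reciprocalConv_succ]; ring
  have e2 : ∑' k : ℕ, 1 / 2 * (1 / (k : ℝ) ^ 2) * ‖(-q : ℂ)‖ ^ (2 * k)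
      = 1 / 2 * shiftSeries (fun k => 1 / ((k : ℝ) + 1) ^ 2) (q ^ 2) := by
    have hs : Summable fun k : ℕ => 1 / 2 * (1 / (k : ℝ) ^ 2) * ‖(-q : ℂ)‖ ^ (2 * k) := by
      refine ((Real.summable_one_div_nat_pow (p := 2).2 one_lt_two).mul_left (1 / 2)).of_nonneg_of_le
        (fun _ => by positivity) fun k => ?_
      exact mul_le_of_le_one_right (by positivity)
        (pow_le_one₀ (norm_nonneg _) (norm_neg_ofReal_lt_one hq hq1).le)
    rw [hs.tsum_eq_zero_add, shiftSeries, ← tsum_mul_left, norm_neg, Complex.norm_real,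
      Real.norm_of_nonneg hq]
    simp only [CharP.cast_eq_zero, ne_eq, OfNat.ofNat_ne_zero, not_false_eq_true, zero_pow,
      div_zero, mul_zero, zero_mul, zero_add, pow_mul, Nat.cast_add, Nat.cast_one, mul_assoc]
  rw [e1, e2] at h2
  linarith

end Landen

/-- The polylogarithm of order `n`. -/
noncomputable def polylogReal (n : ℕ) : ℝ → ℝ := shiftSeries fun k => 1 / ((k : ℝ) + 1) ^ n

lemma summable_one_div_succ_pow {n : ℕ} (hn : 1 < n) :
    Summable fun k : ℕ => 1 / ((k : ℝ) + 1) ^ n := by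
  simpa using (summable_nat_add_iff 1).2 (Real.summable_one_div_nat_pow.2 hn)

lemma abs_one_div_succ_pow_le_one (n k : ℕ) : |1 / ((k : ℝ) + 1) ^ n| ≤ 1 := by
  rw [abs_of_nonneg (by positivity), div_le_one (by positivity)]
  exact one_le_pow₀ (by linarith [(Nat.cast_nonneg k : (0 : ℝ) ≤ k)])

lemma continuousOn_polylogReal {n : ℕ} (hn : 1 < n) :
    ContinuousOn (polylogReal n) (Set.Icc 0 1) :=
  continuousOn_shiftSeries (summable_one_div_succ_pow hn).abs

lemma hasDerivAt_polylogReal (n : ℕ) {t : ℝ} (ht0 : 0 < t) (ht1 : t < 1) :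
    HasDerivAt (polylogReal (n + 1)) (polylogReal n t / t) t := by
  have h := hasDerivAt_shiftSeries (abs_one_div_succ_pow_le_one n) ht0 ht1
  simp_rw [div_div, ← pow_succ] at h
  exact h

lemma polylogReal_one_eq {t : ℝ} (ht0 : 0 ≤ t) (ht1 : t < 1) :
    polylogReal 1 t = -Real.log (1 - t) := by
  rw [← shiftSeries_one_div_succ ht0 ht1, polylogReal]
  simp_rw [pow_one]

/-- The power series with coefficients `H (k - 1) / k ^ 2`. -/
noncomputable def harmonicPolylog : ℝ → ℝ :=
  shiftSeries fun k => harmonicSum k / ((k : ℝ) + 1) ^ 2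

lemma continuousOn_harmonicPolylog : ContinuousOn harmonicPolylog (Set.Icc 0 1) :=
  continuousOn_shiftSeries summable_harmonicSum_div_sq.abs

lemma abs_harmonicSum_div_le_one (k : ℕ) : |harmonicSum k / ((k : ℝ) + 1)| ≤ 1 := by
  rw [abs_of_nonneg (div_nonneg (harmonicSum_nonneg k) (by positivity)),
    div_le_one (by positivity)]
  linarith [harmonicSum_le k]

lemma hasDerivAt_harmonicPolylog {t : ℝ} (ht0 : 0 < t) (ht1 : t < 1) :
    HasDerivAt harmonicPolylog (Real.log (1 - t) ^ 2 / 2 / t) t := by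
  have h := hasDerivAt_shiftSeries abs_harmonicSum_div_le_one ht0 ht1
  rw [shiftSeries_harmonicSum_div ht0.le ht1] at h
  simp_rw [div_div _ ((_ : ℝ) + 1), ← sq] at h
  exact h

lemma harmonicPolylog_one : harmonicPolylog 1 = polylogReal 3 1 := by
  rw [harmonicPolylog, polylogReal, shiftSeries_one, shiftSeries_one, tsum_harmonicSum_div_sq]

lemma HasDerivAt.comp_sq {f : ℝ → ℝ} {f' q : ℝ} (hf : HasDerivAt f f' (q ^ 2)) :
    HasDerivAt (fun q => f (q ^ 2)) (f' * (2 * q)) q := by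
  have h : HasDerivAt (fun q : ℝ => q ^ 2) (2 * q) q := by simpa using hasDerivAt_pow 2 q
  exact HasDerivAt.comp (h₂ := f) (h := fun q => q ^ 2) q hf h

section LandenDeriv

lemma continuousOn_landen : ContinuousOn (fun q : ℝ => 4 * q / (1 + q) ^ 2) (Set.Icc 0 1) := by
  refine ContinuousOn.div (by fun_prop) (by fun_prop) fun q hq => ?_
  have := hq.1
  positivity

lemma mapsTo_landen : Set.MapsTo (fun q : ℝ => 4 * q / (1 + q) ^ 2) (Set.Icc 0 1) (Set.Icc 0 1) := by
  intro q hq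
  have := hq.1
  refine ⟨landen_nonneg hq.1, ?_⟩
  rw [div_le_one (by positivity)]
  nlinarith [sq_nonneg (1 - q)]

lemma mapsTo_sq : Set.MapsTo (fun q : ℝ => q ^ 2) (Set.Icc 0 1) (Set.Icc 0 1) :=
  fun _ hq => ⟨sq_nonneg _, pow_le_one₀ hq.1 hq.2⟩

lemma continuousOn_log_one_add : ContinuousOn (fun q : ℝ => Real.log (1 + q)) (Set.Icc 0 1) := by
  refine ContinuousOn.log (by fun_prop) fun q hq => ?_
  have := hq.1
  positivity

variable {q : ℝ} (hq : q ∈ Set.Ioo (0 : ℝ) 1)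
include hq

lemma hasDerivAt_log_one_add : HasDerivAt (fun q : ℝ => Real.log (1 + q)) (1 / (1 + q)) q := by
  have := hq.1
  exact ((hasDerivAt_id q).const_add 1).log (by positivity)

lemma hasDerivAt_comp_landen {u : ℕ → ℝ} (hu : ∀ k, |u k| ≤ 1) :
    HasDerivAt (fun q => shiftSeries (fun k => u k / (k + 1)) (4 * q / (1 + q) ^ 2))
      (shiftSeries u (4 * q / (1 + q) ^ 2) * (1 / q - 2 / (1 + q))) q := by
  have hq0 := hq.1
  have h1 : HasDerivAt (fun q : ℝ => 4 * q / (1 + q) ^ 2) _ q :=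
    ((hasDerivAt_id q).const_mul 4).div (((hasDerivAt_id q).const_add 1).pow 2) (by positivity)
  have h2 := hasDerivAt_shiftSeries hu (t := 4 * q / (1 + q) ^ 2) (by positivity)
    (landen_lt_one hq.1.le hq.2)
  refine (h2.comp q h1).congr_deriv ?_
  simp only [id]
  push_cast
  field_simp

lemma log_one_sub_sq : Real.log (1 - q ^ 2) = Real.log (1 - q) + Real.log (1 + q) := by
  have h0 := hq.1
  have h1 := hq.2
  rw [← Real.log_mul (by linarith) (by linarith)]
  ring_nf

lemma sq_mem_Ioo : 0 < q ^ 2 ∧ q ^ 2 < 1 :=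
  ⟨pow_pos hq.1 2, pow_lt_one₀ hq.1.le hq.2 two_ne_zero⟩

end LandenDeriv

lemma abs_cosMoment_div_le_one (k : ℕ) : |cosMoment (k + 1) / ((k : ℝ) + 1)| ≤ 1 := by
  rw [abs_of_nonneg (div_nonneg (cosMoment_nonneg _) (by positivity)), div_le_one (by positivity)]
  linarith [cosMoment_le_one (k + 1), (Nat.cast_nonneg k : (0 : ℝ) ≤ k)]

lemma abs_cosMoment_mul_harmonicSum_div_le_one (k : ℕ) :
    |cosMoment (k + 1) * harmonicSum k / ((k : ℝ) + 1)| ≤ 1 := by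
  rw [mul_div_assoc, abs_mul, abs_of_nonneg (cosMoment_nonneg _)]
  exact mul_le_one₀ (cosMoment_le_one _) (abs_nonneg _) (abs_harmonicSum_div_le_one k)

lemma summable_cosMoment_div_sq :
    Summable fun k : ℕ => |cosMoment (k + 1) / ((k : ℝ) + 1) / (k + 1)| := by
  refine (summable_one_div_succ_pow one_lt_two).of_nonneg_of_le (fun _ => abs_nonneg _) fun k => ?_
  rw [div_div, ← sq, abs_of_nonneg (div_nonneg (cosMoment_nonneg _) (by positivity))]
  gcongr
  exact cosMoment_le_one _

lemma summable_cosMoment_mul_harmonicSum_div_sq :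
    Summable fun k : ℕ => |cosMoment (k + 1) * harmonicSum k / ((k : ℝ) + 1) / (k + 1)| := by
  refine summable_harmonicSum_div_sq.of_nonneg_of_le (fun _ => abs_nonneg _) fun k => ?_
  have h := harmonicSum_nonneg k
  rw [div_div, ← sq, abs_of_nonneg
    (div_nonneg (mul_nonneg (cosMoment_nonneg _) h) (by positivity))]
  gcongr
  exact mul_le_of_le_one_left h (cosMoment_le_one _)

lemma tsum_cosMoment_div_sq :
    ∑' k : ℕ, cosMoment (k + 1) / ((k : ℝ) + 1) / (k + 1)
      = polylogReal 2 1 - 2 * Real.log 2 ^ 2 := by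
  have h := eq_of_hasDerivAt_eq
    (f := fun q => shiftSeries (fun k => cosMoment (k + 1) / ((k : ℝ) + 1) / (k + 1))
      (4 * q / (1 + q) ^ 2))
    (g := fun q => 2 * polylogReal 2 q - polylogReal 2 (q ^ 2) - 2 * Real.log (1 + q) ^ 2)
    (f' := fun q => 2 * Real.log (1 + q) * (1 / q - 2 / (1 + q)))
    ((continuousOn_shiftSeries summable_cosMoment_div_sq).comp continuousOn_landen mapsTo_landen)
    (((continuousOn_const.mul (continuousOn_polylogReal one_lt_two)).sub
      ((continuousOn_polylogReal one_lt_two).comp (by fun_prop) mapsTo_sq)).sub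
        (continuousOn_const.mul (continuousOn_log_one_add.pow 2)))
    (by simp [shiftSeries_zero, polylogReal])
    (fun q hq => by
      rw [← shiftSeries_cosMoment_div hq.1.le hq.2]
      exact hasDerivAt_comp_landen hq abs_cosMoment_div_le_one)
    (fun q hq => by
      have hq0 := hq.1
      obtain ⟨hs0, hs1⟩ := sq_mem_Ioo hq
      have h := ((((hasDerivAt_polylogReal 1 hq.1 hq.2).const_mul 2).sub
        (HasDerivAt.comp_sq (hasDerivAt_polylogReal 1 hs0 hs1))).sub
        (((hasDerivAt_log_one_add hq).pow 2).const_mul 2))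
      refine h.congr_deriv ?_
      rw [polylogReal_one_eq hq.1.le hq.2, polylogReal_one_eq hs0.le hs1, log_one_sub_sq hq]
      push_cast
      field_simp
      ring)
  norm_num [shiftSeries_one] at h
  linarith

lemma tsum_cosMoment_mul_harmonicSum_div_sq :
    ∑' k : ℕ, cosMoment (k + 1) * harmonicSum k / ((k : ℝ) + 1) / (k + 1)
      = 5 / 2 * polylogReal 3 1 - 2 * polylogReal 2 1 * Real.log 2 - 4 / 3 * Real.log 2 ^ 3 := by
  have h23 : 1 < 3 := by norm_num
  have h := eq_of_hasDerivAt_eq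
    (f := fun q => shiftSeries (fun k => cosMoment (k + 1) * harmonicSum k / ((k : ℝ) + 1) / (k + 1))
      (4 * q / (1 + q) ^ 2))
    (g := fun q => 1 / 2 * polylogReal 3 (q ^ 2) - 2 * (polylogReal 2 (q ^ 2) * Real.log (1 + q))
      - 4 / 3 * Real.log (1 + q) ^ 3 + 4 * harmonicPolylog q - 2 * harmonicPolylog (q ^ 2))
    (f' := fun q => (polylogReal 2 (q ^ 2) + 2 * Real.log (1 + q) ^ 2) * (1 / q - 2 / (1 + q)))
    ((continuousOn_shiftSeries summable_cosMoment_mul_harmonicSum_div_sq).comp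
      continuousOn_landen mapsTo_landen)
    (((((continuousOn_const.mul ((continuousOn_polylogReal h23).comp (by fun_prop) mapsTo_sq)).sub
      (continuousOn_const.mul (((continuousOn_polylogReal one_lt_two).comp (by fun_prop)
        mapsTo_sq).mul continuousOn_log_one_add))).sub
      (continuousOn_const.mul (continuousOn_log_one_add.pow 3))).add
      (continuousOn_const.mul continuousOn_harmonicPolylog)).sub
      (continuousOn_const.mul (continuousOn_harmonicPolylog.comp (by fun_prop) mapsTo_sq)))
    (by simp [shiftSeries_zero, polylogReal, harmonicPolylog])
    (fun q hq => by
      rw [polylogReal, ← shiftSeries_cosMoment_mul_harmonicSum hq.1.le hq.2]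
      exact hasDerivAt_comp_landen hq abs_cosMoment_mul_harmonicSum_div_le_one)
    (fun q hq => by
      have hq0 := hq.1
      obtain ⟨hs0, hs1⟩ := sq_mem_Ioo hq
      have h := (((((HasDerivAt.comp_sq (hasDerivAt_polylogReal 2 hs0 hs1)).const_mul (1 / 2)).sub
        (((HasDerivAt.comp_sq (hasDerivAt_polylogReal 1 hs0 hs1)).mul
          (hasDerivAt_log_one_add hq)).const_mul 2)).sub
        (((hasDerivAt_log_one_add hq).pow 3).const_mul (4 / 3))).add
        ((hasDerivAt_harmonicPolylog hq.1 hq.2).const_mul 4)).sub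
        ((HasDerivAt.comp_sq (hasDerivAt_harmonicPolylog hs0 hs1)).const_mul 2)
      refine h.congr_deriv ?_
      rw [polylogReal_one_eq hs0.le hs1, log_one_sub_sq hq]
      push_cast
      field_simp
      ring)
  norm_num [shiftSeries_one, harmonicPolylog_one] at h
  linarith

lemma ofReal_polylogReal_one {n : ℕ} (hn : 1 < n) : (polylogReal n 1 : ℂ) = riemannZeta n := by
  rw [zeta_nat_eq_tsum_of_gt_one hn, polylogReal, shiftSeries_one]
  have h := (Real.summable_one_div_nat_pow (p := n)).2 hn
  have h2 := h.tsum_eq_zero_add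
  rw [Nat.cast_zero, zero_pow (by omega), div_zero, zero_add] at h2
  simp only [Nat.cast_add, Nat.cast_one] at h2
  rw [← h2, Complex.ofReal_tsum]
  simp

lemma higherMahler_two_polyXYC_two :
    higherMahler 2 (polyXYC 2) = polylogReal 2 1 / 2 := by
  have h := tsum_cosMoment_div_sq
  rw [higherMahler_two_polyXYC le_rfl]
  have e : ∀ k : ℕ, (Nat.choose (2 * (k + 1)) (k + 1) : ℝ) *
      (1 / (((k + 1 : ℕ) : ℝ) ^ 2 * 2 ^ (2 * (k + 1))))
      = cosMoment (k + 1) / ((k : ℝ) + 1) / (k + 1) := by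
    intro k
    rw [cosMoment]
    push_cast
    field_simp
  simp_rw [e]
  rw [h]
  ring

lemma higherMahler_three_polyXYC_two :
    higherMahler 3 (polyXYC 2) =
      9 / 2 * Real.log 2 * polylogReal 2 1 - 15 / 4 * polylogReal 3 1 := by
  have h := tsum_cosMoment_mul_harmonicSum_div_sq
  have h2 := higherMahler_two_polyXYC_two
  rw [higherMahler_two_polyXYC le_rfl] at h2
  rw [higherMahler_three_polyXYC le_rfl]
  have e : ∀ k : ℕ, (Nat.choose (2 * (k + 1)) (k + 1) : ℝ) *
      (1 / (((k + 1 : ℕ) : ℝ) ^ 2 * 2 ^ (2 * (k + 1)))) * harmonicSum k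
      = cosMoment (k + 1) * harmonicSum k / ((k : ℝ) + 1) / (k + 1) := by
    intro k
    rw [cosMoment]
    push_cast
    field_simp
  simp_rw [e]
  rw [h]
  linear_combination 3 * Real.log 2 * h2

theorem mainTheorem4 :
    (∀ c : ℝ, 2 ≤ c →
      -- (i)
      (∀ s : ℂ, (2 < c ∨ -(3 / 2 : ℝ) < s.re) →
        IntegrableOn (fun θ : Fin 2 → ℝ => (‖torusEval (polyXYC c) θ‖ : ℂ) ^ s)
          (Set.Icc 0 1) ∧
        Summable (fun j : ℕ =>
          Ring.choose (s / 2) j ^ 2 * (1 / (c : ℂ) ^ (2 * j)) * (Nat.choose (2 * j) j : ℂ)) ∧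
        zetaMahler s (polyXYC c) = (c : ℂ) ^ s * ∑' j : ℕ,
          Ring.choose (s / 2) j ^ 2 * (1 / (c : ℂ) ^ (2 * j)) * (Nat.choose (2 * j) j : ℂ)) ∧
      -- (ii), the summation index is `k + 1`
      (IntegrableOn (fun θ : Fin 2 → ℝ => Real.log ‖torusEval (polyXYC c) θ‖ ^ 2)
          (Set.Icc 0 1) ∧
        Summable (fun k : ℕ =>
          (Nat.choose (2 * (k + 1)) (k + 1) : ℝ) *
            (1 / (((k + 1 : ℕ) : ℝ) ^ 2 * c ^ (2 * (k + 1))))) ∧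
        higherMahler 2 (polyXYC c) = Real.log c ^ 2 + 1 / 2 * ∑' k : ℕ,
          (Nat.choose (2 * (k + 1)) (k + 1) : ℝ) *
            (1 / (((k + 1 : ℕ) : ℝ) ^ 2 * c ^ (2 * (k + 1))))) ∧
      -- (iii), the summation indices are `k + 1` and `k + 2`
      (IntegrableOn (fun θ : Fin 2 → ℝ => Real.log ‖torusEval (polyXYC c) θ‖ ^ 3)
          (Set.Icc 0 1) ∧
        Summable (fun k : ℕ =>
          (Nat.choose (2 * (k + 2)) (k + 2) : ℝ) *
            (1 / (((k + 2 : ℕ) : ℝ) ^ 2 * c ^ (2 * (k + 2)))) *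
              ∑ j ∈ Finset.Icc 1 (k + 1), 1 / (j : ℝ)) ∧
        higherMahler 3 (polyXYC c) = Real.log c ^ 3
          + 3 / 2 * Real.log c * ∑' k : ℕ,
              (Nat.choose (2 * (k + 1)) (k + 1) : ℝ) *
                (1 / (((k + 1 : ℕ) : ℝ) ^ 2 * c ^ (2 * (k + 1))))
          - 3 / 2 * ∑' k : ℕ,
              (Nat.choose (2 * (k + 2)) (k + 2) : ℝ) *
                (1 / (((k + 2 : ℕ) : ℝ) ^ 2 * c ^ (2 * (k + 2)))) *
                  ∑ j ∈ Finset.Icc 1 (k + 1), 1 / (j : ℝ))) ∧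
    -- (iv)
    (higherMahler 2 (polyXYC 2) : ℂ) = riemannZeta 2 / 2 ∧
    -- (v)
    (higherMahler 3 (polyXYC 2) : ℂ) =
      9 / 2 * (Real.log 2 : ℂ) * riemannZeta 2 - 15 / 4 * riemannZeta 3 := by
  refine ⟨fun c hc => ⟨fun s hs => ⟨integrableOn_torusEval_cpow hc hs, summable_zeta_terms hc hs,
    zetaMahler_polyXYC hc hs⟩, ⟨integrableOn_log_pow hc two_ne_zero,
    (summable_nat_add_iff 1).2 (summable_choose_div_sq hc), higherMahler_two_polyXYC hc⟩,
    integrableOn_log_pow hc three_ne_zero, ?_, ?_⟩, ?_, ?_⟩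
  · simpa only [harmonicSum_eq_sum_Icc] using
      (summable_nat_add_iff 1).2 (summable_choose_harmonicSum hc)
  · rw [← tsum_choose_harmonicSum_succ hc]
    exact higherMahler_three_polyXYC hc
  · rw [higherMahler_two_polyXYC_two]
    push_cast
    rw [ofReal_polylogReal_one one_lt_two]
    push_cast
    rfl
  · rw [higherMahler_three_polyXYC_two]
    push_cast
    rw [ofReal_polylogReal_one one_lt_two, ofReal_polylogReal_one (by norm_num : 1 < 3)]
    push_cast
    rfl
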